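/- Let $d\ge 3$ and let $G=\mathbb{Z}^d$ be the nearest-neighbour integer lattice. For $p\in[0,1]$ let $\mathbb{P}_p$ be the law of Bernoulli bond percolation on $G$, under which each edge is independently open with probability $p$; let $C_x$ denote the open cluster of a vertex $x$ (the vertices joined to $x$ by open paths, with all open edges between them), and let $p_c(G)=\inf\{p\in(0,1):\mathbb{P}_p(|C_0|=\infty)>0\}$. For a subgraph $H$ of $G$ let the enlargement $\mathcal{U}(H)$ be the subgraph of $G$ with $$V(\mathcal{U}(H))=\bigcup_{x\in V(H)}V(C_x),\qquad E(\mathcal{U}(H))=E(H)\cup\bigcup_{x\in V(H)}E(C_x).$$ A vertex $x$ of a connected graph is called a cut point if there is an edge $e$ containing $x$ such that removing $e$ (but not its endpoints) splits the graph into two infinite connected components. Let $P^{0,0}$ be the law of two independent simple random walks on $\mathbb{Z}^d$ started at $0$, and let $H$ be the trace of the resulting two-sided walk, i.e. the subgraph of all vertices visited and all edges traversed by either of the two walks. If $p>p_c(G)$, then $\mathcal{U}(H)$ has no cut points, $P^{0,0}\otimes\mathbb{P}_p$-almost surely. -/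

import Mathlib

open MeasureTheory

namespace PercEnlarge

section Percolation

variable {V : Type*} {G : SimpleGraph V}

/-- The law of Bernoulli bond percolation on `G`: a configuration is a function `ω` on the edges,
an edge `e` is open if `ω e = true`, and the edges are open independently with probability `p`. -/
noncomputable def percolation (G : SimpleGraph V) (p : unitInterval) :
    Measure (G.edgeSet → Bool) :=
  Measure.infinitePi fun _ => ProbabilityTheory.bernoulliMeasure true false p

instance (G : SimpleGraph V) (p : unitInterval) : IsProbabilityMeasure (percolation G p) := by
  unfold percolation
  infer_instance

/-- The graph on `V` whose edges are the open edges. -/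
def openGraph (ω : G.edgeSet → Bool) : SimpleGraph V where
  Adj x y := ∃ h : s(x, y) ∈ G.edgeSet, ω ⟨s(x, y), h⟩ = true
  symm := ⟨fun x y h => by simpa only [Sym2.eq_swap (a := y) (b := x)] using h⟩
  loopless := ⟨fun x h => by
    obtain ⟨h, -⟩ := h
    exact G.irrefl ((SimpleGraph.mem_edgeSet G).1 h)⟩

theorem openGraph_le (ω : G.edgeSet → Bool) : openGraph ω ≤ G :=
  fun _ _ h => (SimpleGraph.mem_edgeSet G).1 h.choose

/-- The open cluster of `x`, as a subgraph of `G` (all vertices joined to `x` by an open path,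
and all open edges between them). -/
def cluster (ω : G.edgeSet → Bool) (x : V) : G.Subgraph where
  verts := {y | (openGraph ω).Reachable x y}
  Adj u v := (openGraph ω).Reachable x u ∧ (openGraph ω).Adj u v
  adj_sub h := openGraph_le ω h.2
  edge_vert h := h.1
  symm := ⟨fun _ _ h => ⟨h.1.trans h.2.reachable, h.2.symm⟩⟩

/-- The critical probability of `G`, computed from the cluster of the vertex `x`. The infimum is
taken in the complete lattice `[0, 1]`. -/
noncomputable def criticalProb (G : SimpleGraph V) (x : V) : unitInterval :=
  sInf {p | 0 < p ∧ p < 1 ∧ 0 < percolation G p {ω | (cluster ω x).verts.Infinite}}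

/-- The enlargement of the subgraph `H` by the open clusters of its vertices. -/
def enlargement (ω : G.edgeSet → Bool) (H : G.Subgraph) : G.Subgraph where
  verts := ⋃ x ∈ H.verts, (cluster ω x).verts
  Adj u v := H.Adj u v ∨ ∃ x ∈ H.verts, (cluster ω x).Adj u v
  adj_sub h := h.elim (fun h => h.adj_sub) (fun ⟨_, _, h⟩ => h.adj_sub)
  edge_vert h := by
    rcases h with h | ⟨x, hx, h⟩
    · exact Set.mem_biUnion (H.edge_vert h) (SimpleGraph.Reachable.refl _)
    · exact Set.mem_biUnion hx ((cluster ω x).edge_vert h)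
  symm := ⟨fun _ _ h => h.imp (fun h => h.symm) (fun ⟨x, hx, h⟩ => ⟨x, hx, h.symm⟩)⟩

/-- `x` is a cut point of `X` if there is an edge `e` of `X` containing `x` such that removing `e`
(but not its endpoints) splits `X` into two infinite connected components. -/
def IsCutPoint (X : G.Subgraph) (x : V) : Prop :=
  ∃ e ∈ X.edgeSet, x ∈ e ∧
    Nat.card (X.deleteEdges {e}).coe.ConnectedComponent = 2 ∧
    ∀ C : (X.deleteEdges {e}).coe.ConnectedComponent, C.supp.Infinite

/-- The trace of a path: the vertices it visits and the edges it traverses. -/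
def trace (G : SimpleGraph V) (S : ℕ → V) : G.Subgraph where
  verts := Set.range S
  Adj u v := G.Adj u v ∧ ∃ n, (S n = u ∧ S (n + 1) = v) ∨ (S n = v ∧ S (n + 1) = u)
  adj_sub h := h.1
  edge_vert := by
    rintro u v ⟨-, n, h | h⟩
    exacts [⟨n, h.1⟩, ⟨n + 1, h.2⟩]
  symm := ⟨fun _ _ ⟨h, n, h'⟩ => ⟨h.symm, n, h'.symm⟩⟩

end Percolation

section Walk

/-- The nearest-neighbour graph on `ℤ^d`. -/
def lattice (d : ℕ) : SimpleGraph (Fin d → ℤ) where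
  Adj x y := ∑ i, |x i - y i| = 1
  symm := ⟨fun x y h => by simpa only [abs_sub_comm] using h⟩
  loopless := ⟨fun x h => by simp at h⟩

/-- The path started at `x` with increments `ξ 0, ξ 1, …`. -/
def walk {d : ℕ} (x : Fin d → ℤ) (ξ : ℕ → Fin d → ℤ) (n : ℕ) : Fin d → ℤ :=
  x + ∑ k ∈ Finset.range n, ξ k

theorem measurable_walk {d : ℕ} (x : Fin d → ℤ) : Measurable (walk x) := by
  unfold walk
  fun_prop

/-- The law on path space of the simple random walk on `ℤ^d` started at `x`: the increments are
independent and uniformly distributed on the neighbours of the origin. -/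
noncomputable def srw (d : ℕ) (x : Fin d → ℤ) : Measure (ℕ → Fin d → ℤ) :=
  (Measure.infinitePi fun _ : ℕ =>
    ProbabilityTheory.uniformOn ((lattice d).neighborSet 0)).map (walk x)

theorem isProbabilityMeasure_srw {d : ℕ} (hd : 0 < d) (x : Fin d → ℤ) :
    IsProbabilityMeasure (srw d x) := by
  have hfin : ((lattice d).neighborSet 0).Finite := by
    refine Set.Finite.subset (Set.finite_Icc (fun _ => -1 : Fin d → ℤ) (fun _ => 1)) ?_
    intro y hy
    have hy' : ∑ i, |(0 : Fin d → ℤ) i - y i| = 1 := hy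
    have key : ∀ i, |y i| ≤ 1 := by
      intro i
      have := Finset.single_le_sum (f := fun i => |(0 : Fin d → ℤ) i - y i|)
        (fun i _ => abs_nonneg _) (Finset.mem_univ i)
      simpa [hy'] using this.trans hy'.le
    exact ⟨fun i => (abs_le.1 (key i)).1, fun i => (abs_le.1 (key i)).2⟩
  have hne : ((lattice d).neighborSet 0).Nonempty := by
    refine ⟨Pi.single ⟨0, hd⟩ 1, ?_⟩
    change ∑ i, |(0 : Fin d → ℤ) i - (Pi.single (⟨0, hd⟩ : Fin d) (1 : ℤ) : Fin d → ℤ) i| = 1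
    rw [Finset.sum_eq_single (⟨0, hd⟩ : Fin d)]
    · simp
    · intro i _ hi
      simp [hi]
    · simp
  have := ProbabilityTheory.isProbabilityMeasure_uniformOn hfin hne
  exact Measure.isProbabilityMeasure_map (measurable_walk x).aemeasurable

/-- The law of two independent simple random walks on `ℤ^d` started at `x` and `y`. -/
noncomputable def srwPair (d : ℕ) (x y : Fin d → ℤ) :
    Measure ((ℕ → Fin d → ℤ) × (ℕ → Fin d → ℤ)) :=
  (srw d x).prod (srw d y)

/-- The trace of the two-sided walk on `ℤ^d` with the two branches `S.1` and `S.2`. -/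
def twoSidedTrace {d : ℕ} (S : (ℕ → Fin d → ℤ) × (ℕ → Fin d → ℤ)) : (lattice d).Subgraph :=
  trace (lattice d) S.1 ⊔ trace (lattice d) S.2

end Walk

end PercEnlarge

namespace PercEnlarge

open Filter ProbabilityTheory
open scoped ENNReal Topology

/-! Fix an edge `e`, close it, and let `Y` be the enlargement without `e`. For `p < 1`, closing an
edge preserves almost sure properties (`ae_update`), so the closed configuration still has a unique
infinite cluster. If both branches are transient, each meets that cluster infinitely often and
eventually avoids `e`, so its tail lies in one component of `Y`, the same for both. Every vertex of
another component lies in a finite cluster of one of finitely many vertices: an initial point of a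
branch or an endpoint of `e`. Hence `Y` cannot have two infinite components
(`not_isCutPoint_of_transient`).

Three probabilistic inputs are needed.

Transience is replaced by a dichotomy: a walk returning infinitely often to some vertex takes each
possible step from it infinitely often, by Lévy's Borel–Cantelli lemma, hence traverses every edge
(`ae_isRegularPath`). The enlargement is then the whole lattice, which has no cut points
(`not_isCutPoint_top`).

A transient path hits infinite clusters infinitely often with probability at least the percolation
probability, hence with probability one by a zero-one law (`ae_frequently_infinite`).

Uniqueness of the infinite cluster follows once no closed edge joins two infinite clusters. In a
box, count such edges by summing centred edge states over the edges touching each open component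
that reaches the boundary. An edge between two such components is counted twice, and the excess is
`p` per interface edge. Exploring a component reveals a stopping set of edges, so an exponential
weight over it has mean one; this yields the bound |boundary|/s + 4s|volume| for the expected excess
(`expected_card_interface_le`). Dividing by the volume, then letting the box grow and `s` tend to 0,
gives density zero. -/

/-- Reachability from `x` transfers from `A` to `B` if every edge of `A` starting at a vertex
which is reachable from `x` in both graphs joins vertices that are connected in `B`. -/
theorem reachable_of_forall_adj {V : Type*} {A B : SimpleGraph V} {x y : V}
    (h : ∀ u v, A.Reachable x u → B.Reachable x u → A.Adj u v → B.Reachable x v)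
    (hxy : A.Reachable x y) :
    B.Reachable x y := by
  rw [SimpleGraph.reachable_iff_reflTransGen] at hxy
  induction hxy with
  | refl => exact SimpleGraph.Reachable.refl _
  | tail hr hadj ih => exact h _ _ ((SimpleGraph.reachable_iff_reflTransGen _ _).2 hr) ih hadj

/-! ### Finite modifications, measurability, coupling and the zero-one law for percolation. -/

section General

variable {V : Type*} {G : SimpleGraph V}

theorem mem_cluster_verts {ω : G.edgeSet → Bool} {x y : V} :
    y ∈ (cluster ω x).verts ↔ (openGraph ω).Reachable x y := Iff.rfl

theorem openGraph_mono {ω ω' : G.edgeSet → Bool} (h : ∀ e, ω e = true → ω' e = true) :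
    openGraph ω ≤ openGraph ω' :=
  fun _ _ ⟨hm, ho⟩ => ⟨hm, h _ ho⟩

theorem cluster_verts_eq_of_reachable {ω : G.edgeSet → Bool} {x y : V}
    (h : (openGraph ω).Reachable x y) : (cluster ω x).verts = (cluster ω y).verts := by
  ext z
  exact ⟨fun hz => h.symm.trans hz, fun hz => h.trans hz⟩

theorem cluster_infinite_iff_of_reachable {ω : G.edgeSet → Bool} {x y : V}
    (h : (openGraph ω).Reachable x y) :
    (cluster ω x).verts.Infinite ↔ (cluster ω y).verts.Infinite := by
  rw [cluster_verts_eq_of_reachable h]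

/-- Changing the state of the edges of `F` destroys the infinite cluster of a vertex `x` only if
`x` is now in the finite cluster of an endpoint of an edge in `F`. -/
theorem exists_reachable_endpoint {ω ω' : G.edgeSet → Bool} {F : Set G.edgeSet}
    (h : ∀ e ∉ F, ω e = ω' e) {x : V} (hx : (cluster ω x).verts.Infinite)
    (hx' : ¬ (cluster ω' x).verts.Infinite) :
    ∃ e ∈ F, ∃ a ∈ (e : Sym2 V), (openGraph ω').Reachable x a := by
  by_contra! hcon
  refine hx' (hx.mono fun y hy => ?_)
  refine reachable_of_forall_adj (A := openGraph ω) (fun u v _ hu ⟨hm, ho⟩ => ?_) hy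
  refine hu.trans (SimpleGraph.Adj.reachable ⟨hm, ?_⟩)
  rw [← h _ fun hF => hcon _ hF u (Sym2.mem_mk_left u v) hu]
  exact ho

/-- By `exists_reachable_endpoint` such vertices lie in the finite new clusters of the finitely many
endpoints of `F`. A transient path eventually avoids them, so hitting infinite clusters infinitely
often is a tail event. -/
theorem finite_infinite_diff {ω ω' : G.edgeSet → Bool} {F : Set G.edgeSet} (hF : F.Finite)
    (h : ∀ e ∉ F, ω e = ω' e) :
    {x | (cluster ω x).verts.Infinite ∧ ¬ (cluster ω' x).verts.Infinite}.Finite := by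
  have : (⋃ e ∈ F, ⋃ a ∈ {a | a ∈ (e : Sym2 V) ∧ ¬ (cluster ω' a).verts.Infinite},
      (cluster ω' a).verts).Finite := by
    refine hF.biUnion fun e _ => Set.Finite.biUnion ?_ fun a ha => Set.not_infinite.1 ha.2
    obtain ⟨e, -⟩ := e
    induction e with | _ a b =>
    refine (Set.toFinite {a, b}).subset fun z hz => ?_
    simpa using hz.1
  refine this.subset fun x ⟨hx, hx'⟩ => ?_
  obtain ⟨e, he, a, ha, hr⟩ := exists_reachable_endpoint h hx hx'
  simp only [Set.mem_iUnion]
  exact ⟨e, he, a, ⟨ha, by rwa [← cluster_infinite_iff_of_reachable hr]⟩, hr.symm⟩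

theorem measurableSet_adj (x y : V) :
    MeasurableSet {ω : G.edgeSet → Bool | (openGraph ω).Adj x y} := by
  by_cases h : s(x, y) ∈ G.edgeSet
  · have : {ω : G.edgeSet → Bool | (openGraph ω).Adj x y} =
        (fun ω : G.edgeSet → Bool => ω ⟨s(x, y), h⟩) ⁻¹' {true} := by
      ext ω; exact ⟨fun ⟨_, ho⟩ => ho, fun ho => ⟨h, ho⟩⟩
    rw [this]
    exact measurable_pi_apply _ (measurableSet_singleton _)
  · convert MeasurableSet.empty
    ext ω
    exact ⟨fun ⟨h', _⟩ => h h', False.elim⟩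

theorem measurableSet_reachable [Countable V] (x y : V) :
    MeasurableSet {ω : G.edgeSet → Bool | (openGraph ω).Reachable x y} := by
  have key : ∀ n : ℕ, ∀ x, MeasurableSet
      {ω : G.edgeSet → Bool | ∃ w : (openGraph ω).Walk x y, w.length = n} := by
    intro n
    induction n with
    | zero =>
      intro x
      by_cases h : x = y
      · subst h
        convert MeasurableSet.univ
        ext ω
        exact ⟨fun _ => trivial, fun _ => ⟨.nil, rfl⟩⟩
      · convert MeasurableSet.empty
        ext ω
        exact ⟨fun ⟨w, hw⟩ => h (SimpleGraph.Walk.eq_of_length_eq_zero hw), False.elim⟩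
    | succ n ih =>
      intro x
      have : {ω : G.edgeSet → Bool | ∃ w : (openGraph ω).Walk x y, w.length = n + 1} =
          ⋃ z, {ω | (openGraph ω).Adj x z} ∩
            {ω | ∃ w : (openGraph ω).Walk z y, w.length = n} := by
        ext ω
        simp only [Set.mem_iUnion, Set.mem_inter_iff, Set.mem_ofPred_eq]
        constructor
        · rintro ⟨w, hw⟩
          cases w with
          | nil => simp at hw
          | cons h w => exact ⟨_, h, w, by simpa using hw⟩
        · rintro ⟨z, h, w, hw⟩
          exact ⟨.cons h w, by simpa using hw⟩
      rw [this]
      exact MeasurableSet.iUnion fun z => (measurableSet_adj x z).inter (ih z)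
  have : {ω : G.edgeSet → Bool | (openGraph ω).Reachable x y} =
      ⋃ n : ℕ, {ω | ∃ w : (openGraph ω).Walk x y, w.length = n} := by
    ext ω
    simp only [Set.mem_iUnion, Set.mem_ofPred_eq]
    exact ⟨fun ⟨w⟩ => ⟨_, w, rfl⟩, fun ⟨_, w, _⟩ => ⟨w⟩⟩
  rw [this]
  exact MeasurableSet.iUnion fun n => key n x

theorem measurableSet_infinite [Countable V] (x : V) :
    MeasurableSet {ω : G.edgeSet → Bool | (cluster ω x).verts.Infinite} := by
  have : {ω : G.edgeSet → Bool | (cluster ω x).verts.Infinite} =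
      ⋂ s : Finset V, ⋃ y : {y // y ∉ s}, {ω | (openGraph ω).Reachable x y} := by
    ext ω
    simp only [Set.mem_ofPred_eq, Set.mem_iInter, Set.mem_iUnion, Subtype.exists]
    constructor
    · intro h s
      obtain ⟨y, hy, hys⟩ := h.exists_notMem_finset s
      exact ⟨y, hys, hy⟩
    · intro h hfin
      obtain ⟨y, hys, hy⟩ := h hfin.toFinset
      exact hys (hfin.mem_toFinset.2 hy)
  rw [this]
  exact MeasurableSet.iInter fun s => MeasurableSet.iUnion fun y => measurableSet_reachable x y

theorem measurable_update_prod {ι X : Type*} [DecidableEq ι] [MeasurableSpace X] (i : ι) :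
    Measurable fun z : X × (ι → X) => Function.update z.2 i z.1 := by
  refine measurable_pi_iff.2 fun j => ?_
  by_cases h : j = i
  · subst h; simpa using measurable_fst
  · simp only [ne_eq, h, not_false_eq_true, Function.update_of_ne]
    fun_prop

/-- Resampling one coordinate preserves a product measure. -/
theorem map_update_infinitePi {ι X : Type*} [DecidableEq ι] [MeasurableSpace X] (μ : ι → Measure X)
    [∀ i, IsProbabilityMeasure (μ i)] (i : ι) :
    ((μ i).prod (Measure.infinitePi μ)).map (fun z => Function.update z.2 i z.1) =
      Measure.infinitePi μ := by
  refine Measure.eq_infinitePi μ fun s t ht => ?_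
  have hs : MeasurableSet ((s : Set ι).pi t) := .pi s.countable_toSet fun j _ => ht j
  rw [Measure.map_apply (measurable_update_prod i) hs]
  have : (fun z : X × (ι → X) => Function.update z.2 i z.1) ⁻¹' ((s : Set ι).pi t) =
      (if i ∈ s then t i else Set.univ) ×ˢ (((s.erase i : Finset ι) : Set ι).pi t) := by
    ext ⟨b, ω⟩
    simp only [Set.mem_preimage, Set.mem_pi, Set.mem_prod, Finset.coe_erase, Set.mem_sdiff,
      Finset.mem_coe, Set.mem_singleton_iff]
    constructor
    · refine fun h => ⟨?_, fun j hj => ?_⟩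
      · split_ifs with hi
        · simpa using h i hi
        · trivial
      · simpa [hj.2] using h j hj.1
    · rintro ⟨h1, h2⟩ j hj
      by_cases hji : j = i
      · subst hji; simpa [hj] using h1
      · simpa [hji] using h2 j ⟨hj, hji⟩
  rw [this, Measure.prod_prod, Measure.infinitePi_pi _ fun j _ => ht j]
  split_ifs with hi
  · exact Finset.mul_prod_erase s (fun j => μ j (t j)) hi
  · rw [Finset.erase_eq_of_notMem hi]; simp

theorem bernoulli_true (p : unitInterval) :
    bernoulliMeasure true false p {true} = ENNReal.ofReal p := by
  rw [bernoulliMeasure_apply p (measurableSet_singleton _)]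
  simp [ENNReal.ofReal, Real.toNNReal_of_nonneg p.2.1]
  rfl

theorem bernoulli_false (p : unitInterval) :
    bernoulliMeasure true false p {false} = ENNReal.ofReal (1 - p) := by
  rw [bernoulliMeasure_apply p (measurableSet_singleton _)]
  have : (0 : ℝ) ≤ 1 - p := by linarith [p.2.2]
  simp [ENNReal.ofReal, Real.toNNReal_of_nonneg this]
  rfl

/-- Almost sure properties survive closing or opening a given edge, if this is possible. -/
theorem ae_update [DecidableEq G.edgeSet] {p : unitInterval} {Q : (G.edgeSet → Bool) → Prop}
    (h : ∀ᵐ ω ∂percolation G p, Q ω) (e : G.edgeSet) {b : Bool}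
    (hb : bernoulliMeasure true false p {b} ≠ 0) :
    ∀ᵐ ω ∂percolation G p, Q (Function.update ω e b) := by
  unfold percolation at h ⊢
  rw [← map_update_infinitePi _ e] at h
  -- Fubini gives the property for almost every resampled state of `e`, hence for the atom `b`.
  have h' := Measure.ae_ae_of_ae_prod (ae_of_ae_map (measurable_update_prod e).aemeasurable h)
  exact (ae_iff_of_countable.1 h') b hb

theorem infinite_mono {ω ω' : G.edgeSet → Bool} (h : ∀ e, ω e = true → ω' e = true) {x : V}
    (hx : (cluster ω x).verts.Infinite) : (cluster ω' x).verts.Infinite :=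
  hx.mono fun _ hy => SimpleGraph.Reachable.mono (openGraph_mono h) hy

/-- The standard monotone coupling. -/
theorem map_uniform_eq_percolation (p : unitInterval) :
    (Measure.infinitePi fun _ : G.edgeSet => (volume : Measure unitInterval)).map
      (fun U e => decide (U e ≤ p)) = percolation G p := by
  have hm : Measurable fun u : unitInterval => decide (u ≤ p) :=
    measurable_to_bool (by
      have : (fun u : unitInterval => decide (u ≤ p)) ⁻¹' {true} = Set.Iic p := by ext; simp
      rw [this]; exact measurableSet_Iic)
  have := Measure.infinitePi_map_pi (fun _ : G.edgeSet => (volume : Measure unitInterval))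
    (f := fun _ u => decide (u ≤ p)) fun _ => hm
  rw [this, percolation]
  congr 1
  ext1 e
  refine Measure.ext_of_singleton fun b => ?_
  rw [Measure.map_apply hm (measurableSet_singleton _)]
  cases b
  · rw [bernoulli_false]
    have : (fun u : unitInterval => decide (u ≤ p)) ⁻¹' {false} = Set.Ioi p := by ext; simp
    rw [this, unitInterval.volume_Ioi]
  · rw [bernoulli_true]
    have : (fun u : unitInterval => decide (u ≤ p)) ⁻¹' {true} = Set.Iic p := by ext; simp
    rw [this, unitInterval.volume_Iic]

theorem percolation_infinite_mono [Countable V] {p q : unitInterval} (h : p ≤ q) (x : V) :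
    percolation G p {ω | (cluster ω x).verts.Infinite} ≤
      percolation G q {ω | (cluster ω x).verts.Infinite} := by
  have hm : ∀ p : unitInterval,
      Measurable fun (U : G.edgeSet → unitInterval) e => decide (U e ≤ p) := fun p =>
    measurable_pi_iff.2 fun e => measurable_to_bool (by
      have : (fun U : G.edgeSet → unitInterval => decide (U e ≤ p)) ⁻¹' {true} =
        (fun U : G.edgeSet → unitInterval => U e) ⁻¹' Set.Iic p := by ext; simp
      rw [this]; exact measurable_pi_apply e measurableSet_Iic)
  rw [← map_uniform_eq_percolation p, ← map_uniform_eq_percolation q,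
    Measure.map_apply (hm p) (measurableSet_infinite x),
    Measure.map_apply (hm q) (measurableSet_infinite x)]
  refine measure_mono fun U hU => infinite_mono (fun e he => ?_) hU
  simp only [decide_eq_true_eq] at he ⊢
  exact he.trans h

/-- Kolmogorov's zero-one law for events which do not depend on the states of finitely many
edges. -/
theorem percolation_zero_one {p : unitInterval} {A : Set (G.edgeSet → Bool)} (hA : MeasurableSet A)
    (hinv : ∀ ω ω' : G.edgeSet → Bool, ∀ F : Set G.edgeSet, F.Finite → (∀ e ∉ F, ω e = ω' e) →
      ω ∈ A → ω' ∈ A) :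
    percolation G p A = 0 ∨ percolation G p A = 1 := by
  classical
  let s : G.edgeSet → MeasurableSpace (G.edgeSet → Bool) :=
    fun e => MeasurableSpace.comap (fun ω => ω e) ⊤
  have hle : ∀ e, s e ≤ MeasurableSpace.pi := fun e => (measurable_pi_apply e).comap_le
  have hind : iIndep s (percolation G p) :=
    iIndepFun_infinitePi (P := fun _ : G.edgeSet => bernoulliMeasure true false p)
      (X := fun _ b => b) fun _ => measurable_id
  refine measure_zero_or_one_of_measurableSet_limsup (f := cofinite) (p := Set.Finite)
    (ns := fun F : Finset G.edgeSet => (F : Set G.edgeSet)) hle hind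
    (fun t ht => ht.compl_mem_cofinite) ?_ (fun F => F.finite_toSet)
    (fun e => ⟨{e}, by simp⟩) ?_
  · intro a b
    exact ⟨a ∪ b, by simp, by simp⟩
  · rw [(hasBasis_cofinite).limsup_eq_iInf_iSup]
    simp only [MeasurableSpace.measurableSet_iInf]
    intro F hF
    -- Closing all edges of `F` does not affect membership in `A`, which exhibits `A` as an event
    -- determined by the edges outside `F`.
    let φ : (G.edgeSet → Bool) → G.edgeSet → Bool := fun ω e => if e ∈ F then false else ω e
    have hφ : φ ⁻¹' A = A := by
      ext ω
      constructor
      · exact hinv _ _ F hF fun e he => by simp [φ, he]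
      · exact hinv _ _ F hF fun e he => by simp [φ, he]
    rw [← hφ]
    have hφm : Measurable[⨆ e ∈ Fᶜ, s e] φ := by
      refine @measurable_pi_iff _ _ _ (_) _ _ |>.2 fun e => ?_
      by_cases he : e ∈ F
      · simp only [φ, he, if_true]; exact @measurable_const _ _ (_) (_) _
      · simp only [φ, he, if_false]
        exact (comap_measurable (fun ω : G.edgeSet → Bool => ω e)).mono
          (le_iSup₂_of_le e he le_rfl) le_rfl
    exact hφm hA

/-- A path which visits every vertex finitely often meets infinite clusters infinitely often. -/
theorem ae_frequently_infinite [Countable V] {p : unitInterval} {c : ℝ≥0∞} (hc : 0 < c)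
    (hp : ∀ x, c ≤ percolation G p {ω | (cluster ω x).verts.Infinite}) {S : ℕ → V}
    (hS : ∀ v, ∀ᶠ n in atTop, S n ≠ v) :
    ∀ᵐ ω ∂percolation G p, ∃ᶠ n in atTop, (cluster ω (S n)).verts.Infinite := by
  have hset : {ω : G.edgeSet → Bool | ∃ᶠ n in atTop, (cluster ω (S n)).verts.Infinite} =
      ⋂ N : ℕ, ⋃ n ∈ Set.Ici N, {ω | (cluster ω (S n)).verts.Infinite} := by
    ext ω
    simp [frequently_atTop]
  have hmeasN : ∀ N : ℕ, MeasurableSet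
      (⋃ n ∈ Set.Ici N, {ω : G.edgeSet → Bool | (cluster ω (S n)).verts.Infinite}) := fun N =>
    MeasurableSet.biUnion (Set.to_countable _) fun n _ => measurableSet_infinite (S n)
  have hmeas : MeasurableSet
      {ω : G.edgeSet → Bool | ∃ᶠ n in atTop, (cluster ω (S n)).verts.Infinite} := by
    rw [hset]; exact MeasurableSet.iInter hmeasN
  -- The events "some hit after time `N`" decrease in `N` and each has probability at least `c`, so
  -- the bound passes to their intersection.
  have hpos : c ≤ percolation G p {ω | ∃ᶠ n in atTop, (cluster ω (S n)).verts.Infinite} := by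
    rw [hset, Antitone.measure_iInter]
    · refine le_iInf fun N => (hp (S N)).trans (measure_mono ?_)
      exact Set.subset_biUnion_of_mem 
        (u := fun n => {ω : G.edgeSet → Bool | (cluster ω (S n)).verts.Infinite}) Set.self_mem_Ici
    · intro a b hab
      exact Set.biUnion_subset_biUnion_left (Set.Ici_subset_Ici.2 hab)
    · exact fun N => (hmeasN N).nullMeasurableSet
    · exact ⟨0, measure_ne_top _ _⟩
  have h01 := percolation_zero_one (p := p) hmeas ?_
  · exact (prob_compl_eq_zero_iff hmeas).2 (h01.resolve_left (hc.trans_le hpos).ne')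
  · intro ω ω' F hF h hω
    have hfin := finite_infinite_diff hF h
    have hev : ∀ᶠ n in atTop, S n ∉
        {x | (cluster ω x).verts.Infinite ∧ ¬ (cluster ω' x).verts.Infinite} := by
      have := (eventually_all_finite hfin).2 fun v _ => hS v
      filter_upwards [this] with n hn hmem
      exact hn _ hmem rfl
    refine (hω.and_eventually hev).mono fun n hn => ?_
    by_contra hcon
    exact hn.2 ⟨hn.1, hcon⟩

end General


/-! ### Finite product weights and stopping sets of coordinates. -/

section StoppingSet

variable {ι : Type*} [Fintype ι] [DecidableEq ι]

theorem sum_prod_bool_eq_one {q : ι → Bool → ℝ} (hq : ∀ e, q e true + q e false = 1) :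
    ∑ a : ι → Bool, ∏ e, q e (a e) = 1 := by
  have := Finset.prod_univ_sum (fun _ : ι => (Finset.univ : Finset Bool)) q
  rw [Fintype.piFinset_univ] at this
  rw [← this]
  exact Finset.prod_eq_one fun e _ => by rw [Fintype.sum_bool, hq]

/-- Changing the law of the coordinates revealed by a stopping set `T` does not change the total
mass. -/
theorem sum_prod_stoppingSet {q q' : Bool → ℝ} (hq : q true + q false = 1)
    (hq' : q' true + q' false = 1) {T : (ι → Bool) → Finset ι}
    (hT : ∀ a b, (∀ e ∈ T a, a e = b e) → T b = T a) :
    ∑ a : ι → Bool, ∏ e, (if e ∈ T a then q' (a e) else q (a e)) = 1 := by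
  -- Exchange two independent samples off the stopping set of the first. The first coordinate is
  -- unchanged on that set, so the set is unchanged and the exchange is an involution. Afterwards
  -- the first sample has weight `q'` on the set and `q` off it, while the second sums to one.
  let Φ : (ι → Bool) × (ι → Bool) → (ι → Bool) × (ι → Bool) := fun z =>
    (fun e => if e ∈ T z.1 then z.1 e else z.2 e, fun e => if e ∈ T z.1 then z.2 e else z.1 e)
  have hΦT : ∀ z, T (Φ z).1 = T z.1 := fun z => hT _ _ fun e he => by simp [Φ, he]
  have hΦ : Function.Involutive Φ := by
    intro z
    ext e
    · change (if e ∈ T (Φ z).1 then (Φ z).1 e else (Φ z).2 e) = z.1 e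
      rw [hΦT]; by_cases he : e ∈ T z.1 <;> simp [Φ, he]
    · change (if e ∈ T (Φ z).1 then (Φ z).2 e else (Φ z).1 e) = z.2 e
      rw [hΦT]; by_cases he : e ∈ T z.1 <;> simp [Φ, he]
  have h1 : ∑ z : (ι → Bool) × (ι → Bool), (∏ e, q' (z.1 e)) * ∏ e, q (z.2 e) = 1 := by
    rw [Fintype.sum_prod_type]
    simp_rw [← Finset.mul_sum, sum_prod_bool_eq_one (q := fun _ => q) fun _ => hq, mul_one]
    exact sum_prod_bool_eq_one (q := fun _ => q') fun _ => hq'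
  rw [← Equiv.sum_comp hΦ.toPerm, Fintype.sum_prod_type] at h1
  rw [← h1]
  refine Finset.sum_congr rfl fun a _ => ?_
  have h2 : ∑ b : ι → Bool, ∏ e, (if e ∈ T a then q (b e) else q' (b e)) = 1 := by
    refine sum_prod_bool_eq_one (q := fun e b => if e ∈ T a then q b else q' b) fun e => ?_
    by_cases he : e ∈ T a <;> simp [he, hq, hq']
  rw [← mul_one (∏ e, _), ← h2, Finset.mul_sum]
  refine Finset.sum_congr rfl fun b _ => ?_
  rw [← Finset.prod_mul_distrib, ← Finset.prod_mul_distrib]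
  refine Finset.prod_congr rfl fun e _ => ?_
  by_cases he : e ∈ T a
  · simp [Φ, he]
  · simp [Φ, he, mul_comm]

/-- Optional stopping for a product martingale: the density `g` turns `q` into another probability
weight on the revealed coordinates, so the total mass stays one. -/
theorem sum_prod_mul_stoppingSet {q g : Bool → ℝ} (hq : q true + q false = 1)
    (hg : q true * g true + q false * g false = 1) {T : (ι → Bool) → Finset ι}
    (hT : ∀ a b, (∀ e ∈ T a, a e = b e) → T b = T a) :
    ∑ a : ι → Bool, (∏ e, q (a e)) * ∏ e ∈ T a, g (a e) = 1 := by
  rw [← sum_prod_stoppingSet (q' := fun b => q b * g b) hq hg hT]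
  refine Finset.sum_congr rfl fun a _ => ?_
  have h : ∏ e ∈ T a, g (a e) = ∏ e, if e ∈ T a then g (a e) else 1 := by
    rw [Finset.prod_ite_mem, Finset.univ_inter]
  rw [h, ← Finset.prod_mul_distrib]
  refine Finset.prod_congr rfl fun e _ => ?_
  by_cases he : e ∈ T a <;> simp [he]

/-- If `W` does not depend on the coordinate `e` and `q · h` has total mass zero, then so does
the product. -/
theorem sum_prod_mul_eq_zero {q h : Bool → ℝ} (hh : q true * h true + q false * h false = 0)
    {W : (ι → Bool) → ℝ} (e : ι) (hW : ∀ a b, W (Function.update a e b) = W a) :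
    ∑ a : ι → Bool, (∏ i, q (a i)) * (h (a e) * W a) = 0 := by
  refine Finset.sum_involution (fun a _ => Function.update a e (!a e)) ?_ ?_ ?_ ?_
  · intro a _
    have h1 : ∀ b : ι → Bool, ∏ i, q (b i) = q (b e) * ∏ i ∈ Finset.univ.erase e, q (b i) :=
      fun b => (Finset.mul_prod_erase _ (fun i => q (b i)) (Finset.mem_univ e)).symm
    have h2 : ∏ i ∈ Finset.univ.erase e, q (Function.update a e (!a e) i) =
        ∏ i ∈ Finset.univ.erase e, q (a i) :=
      Finset.prod_congr rfl fun i hi => by simp [Finset.ne_of_mem_erase hi]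
    rw [hW, h1, h1 (Function.update _ _ _), h2]
    simp only [Function.update_self]
    cases a e <;> simp <;> linear_combination (∏ i ∈ Finset.univ.erase e, q (a i)) * W a * hh
  · intro a _ _ hcon
    have := congrFun hcon e
    simp at this
  · simp
  · intro a _
    ext i
    by_cases hi : i = e
    · subst hi; simp
    · simp [hi]

end StoppingSet

/-! ### Elementary inequalities for exponential weights. -/

theorem sum_image_le_sum {α β : Type*} [DecidableEq β] (s : Finset α) (f : α → β) {h : β → ℝ}
    (hh : ∀ b, 0 ≤ h b) : ∑ b ∈ s.image f, h b ≤ ∑ a ∈ s, h (f a) := by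
  rw [← Finset.sum_fiberwise_of_maps_to (g := f) (t := s.image f)
    (fun a ha => Finset.mem_image_of_mem f ha)]
  refine Finset.sum_le_sum fun b hb => ?_
  obtain ⟨a, ha, rfl⟩ := Finset.mem_image.1 hb
  exact Finset.single_le_sum (f := fun a => h (f a)) (fun _ _ => hh _)
    (Finset.mem_filter.2 ⟨ha, rfl⟩)

theorem sub_two_mul_sq_le_log {x : ℝ} (hx : |x| ≤ 1 / 2) : x - 2 * x ^ 2 ≤ Real.log (1 + x) := by
  have h := abs_le.1 hx
  have hpos : 0 < 1 + x := by linarith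
  refine le_trans ?_ (Real.one_sub_inv_le_log_of_pos hpos)
  rw [← sub_nonneg]
  have : 1 - (1 + x)⁻¹ - (x - 2 * x ^ 2) = x ^ 2 * (1 + 2 * x) * (1 + x)⁻¹ := by
    field_simp; ring
  rw [this]
  have : 0 ≤ 1 + 2 * x := by linarith
  positivity

/-- A deterministic bound for the centred number of open edges by an exponential weight. -/
theorem sum_le_prod_div_add {ι : Type*} (T : Finset ι) (x : ι → ℝ) (hx : ∀ i, |x i| ≤ 1) {s : ℝ}
    (hs : 0 < s) (hs' : s ≤ 1 / 2) :
    ∑ i ∈ T, x i ≤ (∏ i ∈ T, (1 + s * x i)) / s + 2 * s * T.card := by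
  have habs : ∀ i, |s * x i| ≤ 1 / 2 := fun i => by
    rw [abs_mul, abs_of_pos hs]; nlinarith [hx i, abs_nonneg (x i)]
  have hpos : ∀ i, 0 < 1 + s * x i := fun i => by linarith [(abs_le.1 (habs i)).1]
  -- Bounding log P by P itself is crude but suffices, since P will have mean one.
  have hlog : Real.log (∏ i ∈ T, (1 + s * x i)) ≤ ∏ i ∈ T, (1 + s * x i) := by
    have := Real.log_le_sub_one_of_pos (Finset.prod_pos fun i (_ : i ∈ T) => hpos i)
    linarith
  rw [Real.log_prod (fun i _ => (hpos i).ne')] at hlog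
  have h2 : ∑ i ∈ T, (s * x i - 2 * s ^ 2) ≤ ∑ i ∈ T, Real.log (1 + s * x i) := by
    refine Finset.sum_le_sum fun i _ => le_trans ?_ (sub_two_mul_sq_le_log (habs i))
    have : x i ^ 2 ≤ 1 := by rw [← sq_abs]; nlinarith [hx i, abs_nonneg (x i)]
    nlinarith [sq_nonneg s]
  rw [Finset.sum_sub_distrib, ← Finset.mul_sum, Finset.sum_const, nsmul_eq_mul] at h2
  rw [div_add' _ _ _ hs.ne', le_div_iff₀ hs]
  linarith

/-! ### Open components in a finite set of edges. -/

section FiniteVolume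

variable {V : Type*} {G : SimpleGraph V}

open Classical in
/-- Extend a configuration on the edges of `F` by closed edges. -/
noncomputable def extendClosed (F : Finset G.edgeSet) (a : F → Bool) (e : G.edgeSet) : Bool :=
  if h : e ∈ F then a ⟨e, h⟩ else false

theorem extendClosed_adj {F : Finset G.edgeSet} {a : F → Bool} {x y : V} :
    (openGraph (extendClosed F a)).Adj x y ↔
      ∃ e : F, ((e : G.edgeSet) : Sym2 V) = s(x, y) ∧ a e = true := by
  constructor
  · rintro ⟨hm, ho⟩
    unfold extendClosed at ho
    split_ifs at ho with h
    exact ⟨⟨_, h⟩, rfl, ho⟩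
  · rintro ⟨⟨⟨e, he⟩, hF⟩, heq, ho⟩
    simp only at heq
    subst heq
    exact ⟨he, by simp [extendClosed, hF, ho]⟩

/-- The edge `e` of `F` touches the set of vertices `K`. -/
def Touches {F : Finset G.edgeSet} (K : Set V) (e : F) : Prop :=
  ∃ u ∈ ((e : G.edgeSet) : Sym2 V), u ∈ K

/-- Exploring the cluster of `v` only queries edges touching it, so the states of those edges
determine the cluster. -/
theorem reachable_of_agree {F : Finset G.edgeSet} {a b : F → Bool} {v u : V}
    (h : ∀ e, Touches {w | (openGraph (extendClosed F a)).Reachable v w} e → a e = b e) :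
    (openGraph (extendClosed F a)).Reachable v u ↔
      (openGraph (extendClosed F b)).Reachable v u := by
  constructor
  · refine reachable_of_forall_adj fun x y hx hx' hxy => hx'.trans ?_
    obtain ⟨e, he, ho⟩ := extendClosed_adj.1 hxy
    rw [h e ⟨x, by simp [he], hx⟩] at ho
    exact (extendClosed_adj.2 ⟨e, he, ho⟩).reachable
  · refine reachable_of_forall_adj fun x y hx hx' hxy => hx'.trans ?_
    obtain ⟨e, he, ho⟩ := extendClosed_adj.1 hxy
    rw [← h e ⟨x, by simp [he], hx'⟩] at ho
    exact (extendClosed_adj.2 ⟨e, he, ho⟩).reachable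

/-- If after the update no explored component touched `e`, the two configurations would agree on
every touched edge and the components would coincide. So whether `e` is touched is independent of
the state of `e`. -/
theorem touches_update {F : Finset G.edgeSet} [DecidableEq F] {D : Finset V}
    {a : F → Bool} {e : F} {b : Bool}
    (h : ∃ d ∈ D, Touches {w | (openGraph (extendClosed F a)).Reachable d w} e) :
    ∃ d ∈ D,
      Touches {w | (openGraph (extendClosed F (Function.update a e b))).Reachable d w} e := by
  by_contra! hcon
  obtain ⟨d, hd, u, hu, hr⟩ := h
  refine hcon d hd ⟨u, hu, (reachable_of_agree fun e' he' => ?_).2 hr⟩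
  by_cases hee : e' = e
  · subst hee; exact absurd he' (hcon d hd)
  · simp [hee]

/-- The closed edges of `F` joining distinct components of the open subgraph of `F` which meet
`D`. -/
def IsFiniteInterface (F : Finset G.edgeSet) (D : Finset V) (a : F → Bool) (e : F) : Prop :=
  a e = false ∧ ∃ x y, ((e : G.edgeSet) : Sym2 V) = s(x, y) ∧
    ¬ (openGraph (extendClosed F a)).Reachable x y ∧
    (∃ d ∈ D, (openGraph (extendClosed F a)).Reachable d x) ∧
    ∃ d ∈ D, (openGraph (extendClosed F a)).Reachable d y

open Classical in
/-- The number of components meeting `D` which are touched by a given edge. -/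
theorem card_touching_components (F : Finset G.edgeSet) (D : Finset V) (a : F → Bool) (e : F) :
    ((D.image (openGraph (extendClosed F a)).connectedComponentMk).filter
      (fun K => Touches K.supp e)).card =
      (if ∃ d ∈ D, Touches {w | (openGraph (extendClosed F a)).Reachable d w} e then 1 else 0) +
      if IsFiniteInterface F D a e then 1 else 0 := by
  obtain ⟨⟨e, heG⟩, heF⟩ := e
  induction e with | _ x y =>
  set O := openGraph (extendClosed F a) with hO
  have hmem : ∀ z, O.connectedComponentMk z ∈ D.image O.connectedComponentMk ↔
      ∃ d ∈ D, O.Reachable d z := fun z => by simp [SimpleGraph.ConnectedComponent.eq]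
  have hcard : ∀ z, ∀ inst : DecidablePred fun K => K = O.connectedComponentMk z,
      (@Finset.filter _ _ inst (D.image O.connectedComponentMk)).card =
        if ∃ d ∈ D, O.Reachable d z then 1 else 0 := by
    intro z inst
    split_ifs with h
    · refine Finset.card_eq_one.2 ⟨O.connectedComponentMk z, ?_⟩
      ext K
      simp only [Finset.mem_filter, Finset.mem_singleton]
      exact ⟨fun hK => hK.2, fun hK => ⟨hK ▸ (hmem z).2 h, hK⟩⟩
    · refine Finset.card_eq_zero.2 (Finset.filter_eq_empty_iff.2 ?_)
      rintro K hK rfl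
      exact h ((hmem z).1 hK)
  have hfilter : (D.image O.connectedComponentMk).filter
      (fun K => Touches K.supp (⟨⟨s(x, y), heG⟩, heF⟩ : F)) =
      (D.image O.connectedComponentMk).filter
        (fun K => K = O.connectedComponentMk x ∨ K = O.connectedComponentMk y) := by
    refine Finset.filter_congr fun K _ => ?_
    simp [Touches, SimpleGraph.ConnectedComponent.mem_supp_iff, eq_comm]
  have htouch : (∃ d ∈ D, Touches {w | O.Reachable d w} (⟨⟨s(x, y), heG⟩, heF⟩ : F)) ↔
      (∃ d ∈ D, O.Reachable d x) ∨ ∃ d ∈ D, O.Reachable d y := by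
    simp only [Touches, Sym2.mem_iff, exists_eq_or_imp, exists_eq_left]
    constructor
    · rintro ⟨d, hd, h | h⟩
      exacts [.inl ⟨d, hd, h⟩, .inr ⟨d, hd, h⟩]
    · rintro (⟨d, hd, h⟩ | ⟨d, hd, h⟩)
      exacts [⟨d, hd, .inl h⟩, ⟨d, hd, .inr h⟩]
  rw [hfilter]
  simp only [htouch]
  -- Connected endpoints give at most one touching component and no interface. Otherwise the edge is
  -- closed, and it is an interface exactly when both components meet `D`.
  by_cases hxy : O.Reachable x y
  · have hint : ¬ IsFiniteInterface F D a ⟨⟨s(x, y), heG⟩, heF⟩ := by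
      rintro ⟨-, x', y', heq, hn, -⟩
      rcases Sym2.eq_iff.1 heq with ⟨rfl, rfl⟩ | ⟨rfl, rfl⟩
      exacts [hn hxy, hn hxy.symm]
    have hyx : (∃ d ∈ D, O.Reachable d y) ↔ ∃ d ∈ D, O.Reachable d x :=
      ⟨fun ⟨d, hd, h⟩ => ⟨d, hd, h.trans hxy.symm⟩, fun ⟨d, hd, h⟩ => ⟨d, hd, h.trans hxy⟩⟩
    have hmk : O.connectedComponentMk y = O.connectedComponentMk x :=
      SimpleGraph.ConnectedComponent.eq.2 hxy.symm
    simp only [if_neg hint, hyx, hmk, or_self, hcard, add_zero]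
  · have hclosed : a ⟨⟨s(x, y), heG⟩, heF⟩ = false := by
      by_contra hcon
      exact hxy (extendClosed_adj.2 ⟨⟨⟨s(x, y), heG⟩, heF⟩, rfl, by simpa using hcon⟩).reachable
    have hint : IsFiniteInterface F D a ⟨⟨s(x, y), heG⟩, heF⟩ ↔
        (∃ d ∈ D, O.Reachable d x) ∧ ∃ d ∈ D, O.Reachable d y := by
      constructor
      · rintro ⟨-, x', y', heq, -, hx, hy⟩
        rcases Sym2.eq_iff.1 heq with ⟨rfl, rfl⟩ | ⟨rfl, rfl⟩
        exacts [⟨hx, hy⟩, ⟨hy, hx⟩]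
      · rintro ⟨hx, hy⟩
        exact ⟨hclosed, x, y, rfl, hxy, hx, hy⟩
    rw [Finset.filter_or, Finset.card_union_of_disjoint]
    · rw [hcard, hcard]
      simp only [hint]
      by_cases h1 : ∃ d ∈ D, O.Reachable d x <;> by_cases h2 : ∃ d ∈ D, O.Reachable d y <;>
        simp [h1, h2]
    · rw [Finset.disjoint_filter]
      rintro K - rfl h
      exact hxy (SimpleGraph.ConnectedComponent.eq.1 h)

end FiniteVolume


/-! ### The expected number of interface edges in a finite volume. -/

section FiniteVolume

variable {V : Type*} {G : SimpleGraph V}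

open Classical in
/-- The edges of `F` which touch the component of `v`. -/
noncomputable def touchedEdges (F : Finset G.edgeSet) (v : V) (a : F → Bool) : Finset F :=
  Finset.univ.filter (Touches {w | (openGraph (extendClosed F a)).Reachable v w})

/-- This is the stopping-set property required by `sum_prod_mul_stoppingSet`. -/
theorem touchedEdges_congr {F : Finset G.edgeSet} {v : V} (a b : F → Bool)
    (h : ∀ e ∈ touchedEdges F v a, a e = b e) : touchedEdges F v b = touchedEdges F v a := by
  have hr : {w | (openGraph (extendClosed F b)).Reachable v w} =
      {w | (openGraph (extendClosed F a)).Reachable v w} := Set.ext fun u =>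
    (reachable_of_agree (u := u) (v := v) (a := a) (b := b) fun e he =>
      h e (by simpa [touchedEdges] using he)).symm
  ext e
  simp only [touchedEdges, Finset.mem_filter, hr]

/-- The mass of a state of an edge. -/
noncomputable def edgeMass (p : ℝ) (b : Bool) : ℝ := if b then p else 1 - p

/-- The centred state of an edge. -/
noncomputable def edgeDev (p : ℝ) (b : Bool) : ℝ := if b then p - 1 else p

-- A deterministic double count. Summing `edgeDev` over touched edges, component by component,
-- counts each touched edge once and each interface edge once more; interface edges are closed, so
-- each extra count contributes `p`. The sum over each component is then bounded by its exponential
-- weight through `sum_le_prod_div_add`.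
open Classical in
theorem mul_card_interface_le {p s : ℝ} (hp0 : 0 ≤ p) (hp1 : p ≤ 1) (hs : 0 < s)
    (hs' : s ≤ 1 / 2) (F : Finset G.edgeSet) (D : Finset V) (a : F → Bool) :
    p * ((Finset.univ.filter (IsFiniteInterface F D a)).card : ℝ) ≤
      (∑ v ∈ D, ∏ e ∈ touchedEdges F v a, (1 + s * edgeDev p (a e))) / s + 4 * s * F.card -
      ∑ e, edgeDev p (a e) *
        if ∃ d ∈ D, Touches {w | (openGraph (extendClosed F a)).Reachable d w} e then 1 else 0 := by
  set O := openGraph (extendClosed F a) with hO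
  set K := D.image O.connectedComponentMk with hK
  let T : O.ConnectedComponent → Finset F := fun C => Finset.univ.filter (Touches C.supp)
  have hdev : ∀ b, |edgeDev p b| ≤ 1 := fun b => by
    cases b <;> simp [edgeDev, abs_le] <;> constructor <;> linarith
  have hcard : ∀ e : F, ((K.filter fun C => Touches C.supp e).card : ℝ) =
      (if ∃ d ∈ D, Touches {w | O.Reachable d w} e then 1 else 0) +
      if IsFiniteInterface F D a e then 1 else 0 := fun e => by
    rw [card_touching_components F D a e]
    push_cast
    rfl
  have hswap : ∀ f : F → ℝ, ∑ C ∈ K, ∑ e ∈ T C, f e =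
      ∑ e, f e * ((K.filter fun C => Touches C.supp e).card : ℝ) := fun f => by
    simp only [T, Finset.sum_filter]
    rw [Finset.sum_comm]
    refine Finset.sum_congr rfl fun e _ => ?_
    rw [← Finset.sum_filter, Finset.sum_const, nsmul_eq_mul, mul_comm]
  have h1 : ∑ C ∈ K, ∑ e ∈ T C, edgeDev p (a e) =
      (∑ e, edgeDev p (a e) * if ∃ d ∈ D, Touches {w | O.Reachable d w} e then 1 else 0) +
      p * ((Finset.univ.filter (IsFiniteInterface F D a)).card : ℝ) := by
    rw [hswap, Finset.card_filter]
    push_cast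
    rw [Finset.mul_sum, ← Finset.sum_add_distrib]
    refine Finset.sum_congr rfl fun e _ => ?_
    rw [hcard, mul_add]
    congr 1
    split_ifs with h
    · simp [h.1, edgeDev]
    · simp
  -- An edge touches at most two components; this turns the error `2 * s` into `4 * s`.
  have h2 : ∑ C ∈ K, ((T C).card : ℝ) ≤ 2 * F.card := by
    have := hswap fun _ => 1
    simp only [Finset.sum_const, nsmul_eq_mul, mul_one, one_mul] at this
    rw [this]
    calc _ ≤ ∑ e : F, (2 : ℝ) := by
          refine Finset.sum_le_sum fun e _ => ?_
          rw [hcard]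
          split_ifs <;> norm_num
      _ = _ := by simp [mul_comm]
  -- Passing from components to their representatives in `D` only adds nonnegative terms, and makes
  -- the stopping sets start from fixed vertices.
  have h3 : ∑ C ∈ K, ∏ e ∈ T C, (1 + s * edgeDev p (a e)) ≤
      ∑ v ∈ D, ∏ e ∈ touchedEdges F v a, (1 + s * edgeDev p (a e)) := by
    refine (sum_image_le_sum D O.connectedComponentMk fun C =>
      Finset.prod_nonneg fun e _ => ?_).trans (le_of_eq (Finset.sum_congr rfl fun v _ => ?_))
    · nlinarith [(abs_le.1 (hdev (a e))).1]
    · have : T (O.connectedComponentMk v) = touchedEdges F v a := by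
        simp only [T, touchedEdges]
        congr! 2
        ext w
        exact SimpleGraph.ConnectedComponent.eq.trans ⟨fun h => h.symm, fun h => h.symm⟩
      rw [this]
  have h4 : ∑ C ∈ K, ∑ e ∈ T C, edgeDev p (a e) ≤
      (∑ C ∈ K, ∏ e ∈ T C, (1 + s * edgeDev p (a e))) / s + 2 * s * ∑ C ∈ K, ((T C).card : ℝ) := by
    rw [Finset.sum_div, Finset.mul_sum, ← Finset.sum_add_distrib]
    exact Finset.sum_le_sum fun C _ =>
      sum_le_prod_div_add (T C) (fun e => edgeDev p (a e)) (fun e => hdev _) hs hs'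
  have h5 := div_le_div_of_nonneg_right h3 hs.le
  have h6 := mul_le_mul_of_nonneg_left h2 (by positivity : 0 ≤ 2 * s)
  linarith

open Classical in
/-- The expected number of interface edges in a finite volume. -/
theorem expected_card_interface_le {p s : ℝ} (hp0 : 0 ≤ p) (hp1 : p ≤ 1) (hs : 0 < s)
    (hs' : s ≤ 1 / 2) (F : Finset G.edgeSet) (D : Finset V) :
    p * ∑ a : F → Bool, (∏ e, edgeMass p (a e)) *
      ((Finset.univ.filter (IsFiniteInterface F D a)).card : ℝ) ≤
      D.card / s + 4 * s * F.card := by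
  have hq : edgeMass p true + edgeMass p false = 1 := by simp [edgeMass]
  have hQ : ∀ a : F → Bool, 0 ≤ ∏ e, edgeMass p (a e) := fun a => Finset.prod_nonneg fun e _ => by
    unfold edgeMass; split_ifs <;> linarith
  -- The factor `1 + s * edgeDev p` has mean one because `edgeDev p` is centred.
  have h1 : ∀ v, ∑ a : F → Bool, (∏ e, edgeMass p (a e)) *
      ∏ e ∈ touchedEdges F v a, (1 + s * edgeDev p (a e)) = 1 := fun v =>
    sum_prod_mul_stoppingSet (g := fun b => 1 + s * edgeDev p b) hq
      (by simp [edgeMass, edgeDev]; ring) touchedEdges_congr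
  -- The centred state of `e` is independent of the event that `e` is touched.
  have h2 : ∀ e : F, ∑ a : F → Bool, (∏ e, edgeMass p (a e)) * (edgeDev p (a e) *
      if ∃ d ∈ D, Touches {w | (openGraph (extendClosed F a)).Reachable d w} e then 1 else 0) = 0 :=
    fun e => sum_prod_mul_eq_zero (h := edgeDev p) (W := fun a =>
      if ∃ d ∈ D, Touches {w | (openGraph (extendClosed F a)).Reachable d w} e then 1 else 0)
      (by simp [edgeMass, edgeDev]; ring) e fun a b => by
        congr 1
        refine propext ⟨fun h => ?_, touches_update⟩
        have := touches_update (b := a e) h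
        rwa [Function.update_idem, Function.update_eq_self] at this
  have h0 := sum_prod_bool_eq_one (ι := F) (q := fun _ => edgeMass p) fun _ => hq
  calc _ = ∑ a : F → Bool, (∏ e, edgeMass p (a e)) *
          (p * ((Finset.univ.filter (IsFiniteInterface F D a)).card : ℝ)) := by
        rw [Finset.mul_sum]
        exact Finset.sum_congr rfl fun a _ => by ring
    _ ≤ ∑ a : F → Bool, (∏ e, edgeMass p (a e)) *
        ((∑ v ∈ D, ∏ e ∈ touchedEdges F v a, (1 + s * edgeDev p (a e))) / s + 4 * s * F.card -
          ∑ e, edgeDev p (a e) *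
          if ∃ d ∈ D, Touches {w | (openGraph (extendClosed F a)).Reachable d w} e then 1 else 0) :=
        Finset.sum_le_sum fun a _ => mul_le_mul_of_nonneg_left
          (mul_card_interface_le hp0 hp1 hs hs' F D a) (hQ a)
    _ = _ := by
        simp_rw [mul_sub, mul_add, Finset.sum_sub_distrib, Finset.sum_add_distrib, mul_div_assoc',
          Finset.mul_sum]
        rw [← Finset.sum_div, ← Finset.sum_mul, h0, Finset.sum_comm]
        simp_rw [h1]
        rw [Finset.sum_comm]
        simp_rw [h2]
        simp

/-- The closed edges joining two distinct infinite open clusters. -/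
def IsInterface (ω : G.edgeSet → Bool) (e : G.edgeSet) : Prop :=
  ω e = false ∧ ∃ x y, (e : Sym2 V) = s(x, y) ∧ ¬ (openGraph ω).Reachable x y ∧
    (cluster ω x).verts.Infinite ∧ (cluster ω y).verts.Infinite

open Classical in
theorem percolation_real_restrict (p : unitInterval) (F : Finset G.edgeSet)
    (B : Finset (F → Bool)) :
    (percolation G p).real {ω | (fun e : F => ω e) ∈ B} = ∑ a ∈ B, ∏ e, edgeMass p (a e) := by
  have hpi : (percolation G p).map F.restrict =
      Measure.pi fun _ : F => bernoulliMeasure true false p :=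
    Measure.infinitePi_map_restrict _
  have hm : Measurable (F.restrict : (G.edgeSet → Bool) → F → Bool) := Finset.measurable_restrict F
  have h1 : {ω : G.edgeSet → Bool | (fun e : F => ω e) ∈ B} = F.restrict ⁻¹' (B : Set (F → Bool)) :=
    rfl
  rw [measureReal_def, h1, ← Measure.map_apply hm B.measurableSet, hpi, ← measureReal_def,
    ← sum_measureReal_singleton B]
  refine Finset.sum_congr rfl fun a _ => ?_
  rw [measureReal_def, Measure.pi_singleton, ENNReal.toReal_prod]
  refine Finset.prod_congr rfl fun e _ => ?_
  cases a e
  · rw [bernoulli_false, ENNReal.toReal_ofReal (by linarith [p.2.2])]; simp [edgeMass]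
  · rw [bernoulli_true, ENNReal.toReal_ofReal p.2.1]; simp [edgeMass]

theorem openGraph_extendClosed_le (F : Finset G.edgeSet) (ω : G.edgeSet → Bool) :
    openGraph (extendClosed F fun e => ω e) ≤ openGraph ω := by
  refine openGraph_mono fun e he => ?_
  unfold extendClosed at he
  split_ifs at he
  exact he

/-- The expected number of edges in a finite volume that join two distinct infinite clusters. -/
theorem sum_interface_le {p : unitInterval} {s : ℝ} (hs : 0 < s) (hs' : s ≤ 1 / 2)
    (F : Finset G.edgeSet) (D : Finset V)
    (hD : ∀ (ω : G.edgeSet → Bool), ∀ e ∈ F, ∀ x ∈ (e : Sym2 V), (cluster ω x).verts.Infinite →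
      ∃ d ∈ D, (openGraph (extendClosed F fun e => ω e)).Reachable d x) :
    p * ∑ e ∈ F, (percolation G p).real {ω | IsInterface ω e} ≤ D.card / s + 4 * s * F.card := by
  classical
  refine le_trans (mul_le_mul_of_nonneg_left ?_ p.2.1)
    (expected_card_interface_le p.2.1 p.2.2 hs hs' F D)
  have h1 : ∀ e : F, (percolation G p).real {ω | IsInterface ω e} ≤
      ∑ a : F → Bool, (∏ e, edgeMass p (a e)) * if IsFiniteInterface F D a e then 1 else 0 := by
    intro e
    have := percolation_real_restrict p F
      (Finset.univ.filter fun a : F → Bool => IsFiniteInterface F D a e)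
    simp only [mul_ite, mul_one, mul_zero]
    rw [← Finset.sum_filter, ← this]
    refine measureReal_mono ?_
    rintro ω ⟨hc, x, y, he, hn, hx, hy⟩
    simp only [Finset.mem_filter, Finset.mem_univ, true_and, Set.mem_ofPred_eq]
    -- Restricting to `F` only removes open edges, so disconnected endpoints stay disconnected; `hD`
    -- supplies the links to `D`.
    exact ⟨hc, x, y, he, fun h => hn (h.mono (openGraph_extendClosed_le F ω)),
      hD ω e e.2 x (by simp [he]) hx, hD ω e e.2 y (by simp [he]) hy⟩
  rw [← Finset.sum_coe_sort]
  refine (Finset.sum_le_sum fun e _ => h1 e).trans (le_of_eq ?_)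
  rw [Finset.sum_comm]
  refine Finset.sum_congr rfl fun a _ => ?_
  rw [← Finset.mul_sum, Finset.card_filter]
  push_cast
  rfl

end FiniteVolume


/-! ### From absence of interfaces to uniqueness, and invariance under automorphisms. -/

section Uniqueness

variable {V : Type*} {G : SimpleGraph V}

theorem measurableSet_isInterface [Countable V] (e : G.edgeSet) :
    MeasurableSet {ω : G.edgeSet → Bool | IsInterface ω e} := by
  have : {ω : G.edgeSet → Bool | IsInterface ω e} = (fun ω : G.edgeSet → Bool => ω e) ⁻¹' {false} ∩
      ⋃ x, ⋃ y, ⋃ _ : (e : Sym2 V) = s(x, y), {ω | (openGraph ω).Reachable x y}ᶜ ∩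
        ({ω | (cluster ω x).verts.Infinite} ∩ {ω | (cluster ω y).verts.Infinite}) := by
    ext ω
    simp only [IsInterface, Set.mem_inter_iff, Set.mem_preimage, Set.mem_singleton_iff,
      Set.mem_iUnion, Set.mem_compl_iff, Set.mem_ofPred_eq, exists_prop]
  rw [this]
  exact (measurable_pi_apply e (measurableSet_singleton _)).inter <|
    .iUnion fun x => .iUnion fun y => .iUnion fun _ => (measurableSet_reachable x y).compl.inter
      ((measurableSet_infinite x).inter (measurableSet_infinite y))

/-- If almost surely no edge joins two distinct infinite clusters then there is at most one
infinite cluster. -/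
theorem ae_unique_of_ae_not_isInterface [Countable V] (hG : G.Preconnected) {p : unitInterval}
    (hp : 0 < p) (h : ∀ e, ∀ᵐ ω ∂percolation G p, ¬ IsInterface ω e) :
    ∀ᵐ ω ∂percolation G p, ∀ x y, (cluster ω x).verts.Infinite →
      (cluster ω y).verts.Infinite → (openGraph ω).Reachable x y := by
  classical
  have hb : bernoulliMeasure true false p {true} ≠ 0 := by
    rw [bernoulli_true]
    exact (ENNReal.ofReal_pos.2 hp).ne'
  rw [ae_all_iff]; intro x
  rw [ae_all_iff]; intro y
  obtain ⟨w⟩ := hG x y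
  induction w with
  | nil => exact ae_of_all _ fun ω _ _ => SimpleGraph.Reachable.refl _
  | @cons x z y hxz w ih =>
    -- Open the first edge of a path from `x` to `y`: then `z` also has an infinite cluster, and
    -- induction connects it to `y`. Without that edge, `y` still reaches `x` or `z`; in the latter
    -- case `x` and `z` must be connected, or the edge would be an interface.
    filter_upwards [ae_update ih ⟨s(x, z), hxz⟩ hb, h ⟨s(x, z), hxz⟩] with ω h1 h2 hx hy
    set ω' := Function.update ω ⟨s(x, z), hxz⟩ true with hω'
    have hle : ∀ e, ω e = true → ω' e = true := fun e he => by
      by_cases hee : e = ⟨s(x, z), hxz⟩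
      · subst hee; simp [ω']
      · simpa [ω', hee] using he
    have hadj : (openGraph ω').Adj x z := ⟨hxz, by simp [ω']⟩
    have hz' := (cluster_infinite_iff_of_reachable hadj.reachable).1 (infinite_mono hle hx)
    have hyz := (h1 hz' (infinite_mono hle hy)).symm
    have hor : (openGraph ω).Reachable y x ∨ (openGraph ω).Reachable y z := by
      by_contra! hcon
      refine hcon.2 (reachable_of_forall_adj (A := openGraph ω') (fun u v _ hu ⟨hm, ho⟩ => ?_) hyz)
      refine hu.trans (SimpleGraph.Adj.reachable ⟨hm, ?_⟩)
      have hne : (⟨s(u, v), hm⟩ : G.edgeSet) ≠ ⟨s(x, z), hxz⟩ := by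
        intro heq
        rcases Sym2.eq_iff.1 (Subtype.ext_iff.1 heq) with ⟨rfl, rfl⟩ | ⟨rfl, rfl⟩
        exacts [hcon.1 hu, hcon.2 hu]
      simpa [ω', hne] using ho
    rcases hor with hyx | hyz
    · exact hyx.symm
    · refine SimpleGraph.Reachable.trans ?_ hyz.symm
      have hz := (cluster_infinite_iff_of_reachable hyz).1 hy
      by_contra hcon
      refine h2 ⟨?_, x, z, rfl, hcon, hx, hz⟩
      by_contra ho
      exact hcon (SimpleGraph.Adj.reachable ⟨hxz, by simpa using ho⟩)

/-- Transport a configuration along an automorphism. -/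
def pullback (φ : G ≃g G) (ω : G.edgeSet → Bool) : G.edgeSet → Bool :=
  fun e => ω (φ.mapEdgeSet e)

theorem measurePreserving_pullback (φ : G ≃g G) (p : unitInterval) :
    MeasurePreserving (pullback φ) (percolation G p) (percolation G p) where
  measurable := by unfold pullback; fun_prop
  map_eq := Measure.map_infinitePi_infinitePi_of_inj φ.mapEdgeSet.injective

/-- The isomorphism between the open graphs of a configuration and of its pullback. -/
def pullbackIso (φ : G ≃g G) (ω : G.edgeSet → Bool) : openGraph (pullback φ ω) ≃g openGraph ω where
  toEquiv := φ.toEquiv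
  map_rel_iff' := ⟨fun ⟨h, ho⟩ => ⟨φ.map_adj_iff.1 h, ho⟩, fun ⟨h, ho⟩ =>
    ⟨φ.map_adj_iff.2 h, ho⟩⟩

theorem pullback_reachable (φ : G ≃g G) (ω : G.edgeSet → Bool) (x y : V) :
    (openGraph (pullback φ ω)).Reachable x y ↔ (openGraph ω).Reachable (φ x) (φ y) :=
  (SimpleGraph.Iso.reachable_iff (φ := pullbackIso φ ω)).symm

theorem pullback_infinite (φ : G ≃g G) (ω : G.edgeSet → Bool) (x : V) :
    (cluster (pullback φ ω) x).verts.Infinite ↔ (cluster ω (φ x)).verts.Infinite := by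
  have : (cluster ω (φ x)).verts = φ '' (cluster (pullback φ ω) x).verts := by
    ext y
    refine ⟨fun hy => ⟨φ.symm y, ?_, by simp⟩, ?_⟩
    · rw [mem_cluster_verts, pullback_reachable, φ.apply_symm_apply]
      exact hy
    · rintro ⟨z, hz, rfl⟩
      exact (pullback_reachable φ ω x z).1 hz
  rw [this, Set.infinite_image_iff φ.injective.injOn]

theorem pullback_isInterface (φ : G ≃g G) (ω : G.edgeSet → Bool) (e : G.edgeSet) :
    IsInterface (pullback φ ω) e ↔ IsInterface ω (φ.mapEdgeSet e) := by
  simp only [IsInterface, pullback_reachable, pullback_infinite]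
  refine and_congr Iff.rfl ⟨?_, ?_⟩
  · rintro ⟨x, y, he, h⟩
    exact ⟨φ x, φ y, by rw [← Sym2.map_mk, ← he]; rfl, h⟩
  · rintro ⟨x, y, he, h⟩
    refine ⟨φ.symm x, φ.symm y, ?_, by simpa using h⟩
    apply Sym2.map.injective φ.injective
    rw [Sym2.map_mk]
    simpa using he

theorem percolation_isInterface_map [Countable V] (φ : G ≃g G) (p : unitInterval) (e : G.edgeSet) :
    percolation G p {ω | IsInterface ω (φ.mapEdgeSet e)} =
      percolation G p {ω | IsInterface ω e} := by
  rw [← (measurePreserving_pullback φ p).measure_preimage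
    (measurableSet_isInterface e).nullMeasurableSet]
  congr 1
  ext ω
  exact (pullback_isInterface φ ω e).symm

theorem percolation_infinite_map [Countable V] (φ : G ≃g G) (p : unitInterval) (x : V) :
    percolation G p {ω | (cluster ω (φ x)).verts.Infinite} =
      percolation G p {ω | (cluster ω x).verts.Infinite} := by
  rw [← (measurePreserving_pullback φ p).measure_preimage
    (measurableSet_infinite x).nullMeasurableSet]
  congr 1
  ext ω
  exact (pullback_infinite φ ω x).symm

end Uniqueness


/-! ### Uniqueness of the infinite cluster on the lattice. -/

section Lattice

variable {d : ℕ}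

theorem lattice_adj_iff {x y : Fin d → ℤ} : (lattice d).Adj x y ↔ ∑ i, |x i - y i| = 1 := Iff.rfl

theorem abs_sub_le_of_adj {x y : Fin d → ℤ} (h : (lattice d).Adj x y) (i : Fin d) :
    |x i - y i| ≤ 1 := by
  rw [lattice_adj_iff] at h
  rw [← h]
  exact Finset.single_le_sum (f := fun i => |x i - y i|) (fun i _ => abs_nonneg _)
    (Finset.mem_univ i)

/-- Translations of the lattice. -/
def translation (a : Fin d → ℤ) : lattice d ≃g lattice d where
  toEquiv := Equiv.addRight a
  map_rel_iff' := by simp [lattice_adj_iff]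

@[simp]
theorem translation_apply (a x : Fin d → ℤ) : translation a x = x + a := rfl

theorem lattice_adj_add_right {x y a : Fin d → ℤ} :
    (lattice d).Adj (x + a) (y + a) ↔ (lattice d).Adj x y := (translation a).map_adj_iff

theorem percolation_infinite_eq (p : unitInterval) (x : Fin d → ℤ) :
    percolation (lattice d) p {ω | (cluster ω x).verts.Infinite} =
      percolation (lattice d) p {ω | (cluster ω 0).verts.Infinite} := by
  simpa using percolation_infinite_map (translation x) p 0

theorem adj_add_single (x : Fin d → ℤ) (i : Fin d) : (lattice d).Adj x (x + Pi.single i 1) := by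
  rw [lattice_adj_iff, Finset.sum_eq_single i]
  · simp
  · intro j _ hj; simp [hj]
  · simp

theorem lattice_preconnected (d : ℕ) : (lattice d).Preconnected := by
  have h1 : ∀ (x : Fin d → ℤ) i (n : ℤ), (lattice d).Reachable x (x + Pi.single i n) := by
    intro x i n
    induction n using Int.induction_on with
    | zero => simp
    | succ n ih =>
      refine ih.trans ?_
      rw [Pi.single_add, ← add_assoc]
      exact (adj_add_single _ i).reachable
    | pred n ih =>
      refine ih.trans ?_
      have := adj_add_single (x + Pi.single i (-(n : ℤ) - 1)) i
      rw [add_assoc, ← Pi.single_add, sub_add_cancel] at this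
      exact this.symm.reachable
  have h2 : ∀ (s : Finset (Fin d)) (x y : Fin d → ℤ),
      (lattice d).Reachable x (x + ∑ i ∈ s, Pi.single i (y i)) := by
    intro s x y
    induction s using Finset.induction_on with
    | empty => simp
    | insert i s hi ih =>
      rw [Finset.sum_insert hi, add_comm (Pi.single i (y i) : Fin d → ℤ), ← add_assoc]
      exact ih.trans (h1 _ _ _)
  intro x y
  have := h2 Finset.univ x (y - x)
  rwa [Finset.univ_sum_single, add_sub_cancel] at this

/-- The box of radius `n`. -/
noncomputable def box (d n : ℕ) : Finset (Fin d → ℤ) := Finset.Icc (fun _ => -(n : ℤ)) fun _ => n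

theorem mem_box {n : ℕ} {x : Fin d → ℤ} : x ∈ box d n ↔ ∀ i, |x i| ≤ n := by
  simp [box, Pi.le_def, abs_le, forall_and]

theorem card_box (d n : ℕ) : (box d n).card = (2 * n + 1) ^ d := by
  rw [box, Pi.card_Icc]
  simp only [Int.card_Icc, Finset.prod_const, Finset.card_univ, Fintype.card_fin]
  congr 1
  omega

theorem mem_box_succ_of_adj {n : ℕ} {x y : Fin d → ℤ} (hx : x ∈ box d n)
    (h : (lattice d).Adj x y) : y ∈ box d (n + 1) := by
  rw [mem_box] at hx ⊢
  intro i
  have h1 := abs_le.1 (abs_sub_le_of_adj h i)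
  have h2 := abs_le.1 (hx i)
  rw [abs_le]
  push_cast
  constructor <;> linarith

theorem box_mono {m n : ℕ} (h : m ≤ n) : box d m ⊆ box d n := fun x hx => by
  rw [mem_box] at hx ⊢
  exact fun i => (hx i).trans (by exact_mod_cast h)

/-- The edges with both endpoints in the box of radius `n`. -/
noncomputable def boxEdges (d n : ℕ) : Finset (lattice d).edgeSet :=
  Set.Finite.toFinset (s := {e | ∀ x ∈ (e : Sym2 (Fin d → ℤ)), x ∈ box d n}) (by
    refine Set.Finite.of_finite_image (f := Subtype.val) ?_ Subtype.val_injective.injOn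
    refine ((box d n).sym2.finite_toSet).subset ?_
    rintro _ ⟨e, he, rfl⟩
    exact Finset.mem_coe.2 (Finset.mem_sym2_iff.2 he))

theorem mem_boxEdges {n : ℕ} {e : (lattice d).edgeSet} :
    e ∈ boxEdges d n ↔ ∀ x ∈ (e : Sym2 (Fin d → ℤ)), x ∈ box d n := by
  simp [boxEdges]

theorem card_boxEdges_le (d n : ℕ) : (boxEdges d n).card ≤ 3 ^ d * (2 * n + 1) ^ d := by
  classical
  have hsub : (boxEdges d n).image Subtype.val ⊆
      ((box d n) ×ˢ (box d 1)).image fun z => s(z.1, z.1 + z.2) := by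
    intro e' he'
    obtain ⟨⟨e, hG⟩, he, rfl⟩ := Finset.mem_image.1 he'
    clear he'
    induction e with | _ x y =>
    refine Finset.mem_image.2 ⟨(x, y - x), Finset.mem_product.2 ⟨?_, ?_⟩, by simp⟩
    · exact mem_boxEdges.1 he x (by simp)
    · rw [mem_box]
      intro i
      have := abs_sub_le_of_adj (SimpleGraph.mem_edgeSet _ |>.1 hG).symm i
      simpa using this
  calc (boxEdges d n).card = ((boxEdges d n).image Subtype.val).card :=
        (Finset.card_image_of_injective _ Subtype.val_injective).symm
    _ ≤ _ := Finset.card_le_card hsub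
    _ ≤ _ := Finset.card_image_le
    _ = _ := by rw [Finset.card_product, card_box, card_box]; ring

/-- An infinite cluster leaves the box. The last vertex before the first exit lies in the outer
shell, and the open path up to it uses only edges of the box. -/
theorem exists_boundary_reachable {n : ℕ} (ω : (lattice d).edgeSet → Bool) {x : Fin d → ℤ}
    (hx : x ∈ box d (n + 1)) (hinf : (cluster ω x).verts.Infinite) :
    ∃ y ∈ box d (n + 1) \ box d n,
      (openGraph (extendClosed (boxEdges d (n + 1)) fun e => ω e)).Reachable y x := by
  obtain ⟨z, hz, hzb⟩ := hinf.exists_notMem_finset (box d (n + 1))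
  rw [mem_cluster_verts, SimpleGraph.reachable_iff_reflTransGen] at hz
  induction hz using Relation.ReflTransGen.head_induction_on with
  | refl => exact absurd hx hzb
  | @head x y hxy _ ih =>
    obtain ⟨hG, ho⟩ := hxy
    by_cases hy : y ∈ box d (n + 1)
    · have hinf' : (cluster ω y).verts.Infinite :=
        (cluster_infinite_iff_of_reachable (SimpleGraph.Adj.reachable ⟨hG, ho⟩)).1 hinf
      obtain ⟨v, hv, hr⟩ := ih hy hinf'
      refine ⟨v, hv, hr.trans (SimpleGraph.Adj.reachable ?_)⟩
      have hmem : (⟨s(x, y), hG⟩ : (lattice d).edgeSet) ∈ boxEdges d (n + 1) := by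
        rw [mem_boxEdges]
        intro u hu
        rcases Sym2.mem_iff.1 hu with rfl | rfl
        exacts [hx, hy]
      exact (extendClosed_adj.2 ⟨⟨_, hmem⟩, rfl, ho⟩ :
        (openGraph (extendClosed (boxEdges d (n + 1)) fun e => ω e)).Adj x y).symm
    · exact ⟨x, Finset.mem_sdiff.2 ⟨hx, fun h => hy (mem_box_succ_of_adj h hG)⟩,
        SimpleGraph.Reachable.refl _⟩

/-- The finite volume bound for the probability that a given edge joins two distinct infinite
clusters. -/
theorem mul_interface_le {p : unitInterval} {s : ℝ} (hs : 0 < s) (hs' : s ≤ 1 / 2) (n : ℕ)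
    {u : Fin d → ℤ} (hu : (lattice d).Adj 0 u) :
    p * ((percolation (lattice d) p).real {ω | IsInterface ω ⟨s(0, u), hu⟩} *
      (2 * n + 1 : ℝ) ^ d) ≤
      ((2 * (n + 1) + 1 : ℝ) ^ d - (2 * n + 1 : ℝ) ^ d) / s +
        4 * s * (3 ^ d * (2 * (n + 1) + 1 : ℝ) ^ d) := by
  classical
  have h0 := sum_interface_le (p := p) hs hs' (boxEdges d (n + 1)) (box d (n + 1) \ box d n)
    fun ω e he x hx hinf => exists_boundary_reachable ω (mem_boxEdges.1 he x hx) hinf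
  let f : (Fin d → ℤ) → (lattice d).edgeSet := fun x => (translation x).mapEdgeSet ⟨s(0, u), hu⟩
  have hf : ∀ x, (f x : Sym2 (Fin d → ℤ)) = s(x, u + x) := fun x => by
    simp [f, SimpleGraph.Iso.mapEdgeSet, SimpleGraph.Hom.mapEdgeSet]
  have hu0 : u ≠ 0 := fun h => (lattice d).loopless.irrefl 0 (h ▸ hu)
  -- Two translates can coincide with reversed orientation only if 2u = 0.
  have hinj : Function.Injective f := by
    intro x y hxy
    have h := congrArg Subtype.val hxy
    rw [hf, hf, Sym2.eq_iff] at h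
    rcases h with h | ⟨h1, h2⟩
    · exact h.1
    · exfalso
      apply hu0
      rw [h1] at h2
      funext i
      have := congrFun h2 i
      simp at this ⊢
      omega
  have hsub : (box d n).image f ⊆ boxEdges d (n + 1) := by
    intro e he
    obtain ⟨x, hx, rfl⟩ := Finset.mem_image.1 he
    rw [mem_boxEdges, hf]
    intro v hv
    rcases Sym2.mem_iff.1 hv with rfl | rfl
    · exact box_mono (Nat.le_succ n) hx
    · refine mem_box_succ_of_adj hx ?_
      have := lattice_adj_add_right (a := x).2 hu
      rwa [zero_add] at this
  have h1 : (percolation (lattice d) p).real {ω | IsInterface ω ⟨s(0, u), hu⟩} *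
      (2 * n + 1 : ℝ) ^ d ≤
      ∑ e ∈ boxEdges d (n + 1), (percolation (lattice d) p).real {ω | IsInterface ω e} := by
    refine le_trans (le_of_eq ?_) (Finset.sum_le_sum_of_subset_of_nonneg hsub
      fun _ _ _ => measureReal_nonneg)
    rw [Finset.sum_image hinj.injOn]
    have : ∀ x, (percolation (lattice d) p).real {ω | IsInterface ω (f x)} =
        (percolation (lattice d) p).real {ω | IsInterface ω ⟨s(0, u), hu⟩} := fun x => by
      rw [measureReal_def, percolation_isInterface_map, measureReal_def]
    simp_rw [this]
    rw [Finset.sum_const, card_box, nsmul_eq_mul, mul_comm]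
    push_cast
    rfl
  have hD : ((box d (n + 1) \ box d n).card : ℝ) =
      (2 * (n + 1) + 1 : ℝ) ^ d - (2 * n + 1 : ℝ) ^ d := by
    rw [Finset.cast_card_sdiff (box_mono (Nat.le_succ n)), card_box, card_box]
    push_cast
    rfl
  have hF : ((boxEdges d (n + 1)).card : ℝ) ≤ 3 ^ d * (2 * (n + 1) + 1 : ℝ) ^ d := by
    exact_mod_cast card_boxEdges_le d (n + 1)
  refine (mul_le_mul_of_nonneg_left h1 p.2.1).trans (h0.trans ?_)
  rw [hD]
  gcongr

theorem ae_not_isInterface {p : unitInterval} (hp : 0 < p) (e : (lattice d).edgeSet) :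
    ∀ᵐ ω ∂percolation (lattice d) p, ¬ IsInterface ω e := by
  obtain ⟨e, he⟩ := e
  induction e with | _ x y =>
  have hxy : (lattice d).Adj x y := he
  have hu : (lattice d).Adj 0 (y - x) := by
    rw [← lattice_adj_add_right (a := x)]; simpa using hxy
  have hshift : (translation x).mapEdgeSet ⟨s(0, y - x), hu⟩ = ⟨s(x, y), he⟩ := by
    apply Subtype.ext
    simp [SimpleGraph.Iso.mapEdgeSet, SimpleGraph.Hom.mapEdgeSet]
  have hp' : (0 : ℝ) < p := hp
  set δ := (percolation (lattice d) p).real {ω | IsInterface ω ⟨s(0, y - x), hu⟩} with hδ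
  have hlim : Tendsto (fun n : ℕ => ((2 * n + 1 : ℝ) / (2 * (n + 1) + 1)) ^ d) atTop (𝓝 1) := by
    have h1 : Tendsto (fun n : ℕ => 1 - 2 / (2 * (n + 1 : ℝ) + 1)) atTop (𝓝 (1 - 0)) := by
      refine tendsto_const_nhds.sub (Tendsto.const_div_atTop ?_ _)
      refine tendsto_atTop_add_const_right _ _ (Tendsto.const_mul_atTop two_pos ?_)
      exact tendsto_atTop_add_const_right _ _ tendsto_natCast_atTop_atTop
    have h2 := h1.pow d
    simp only [sub_zero, one_pow] at h2
    refine h2.congr fun n => ?_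
    congr 1
    field_simp
    ring
  -- After division by the volume of the larger box the shell term vanishes as `n` grows; only the
  -- error linear in `s` remains.
  have hbound : ∀ s : ℝ, 0 < s → s ≤ 1 / 2 → p * δ ≤ 4 * s * 3 ^ d := by
    intro s hs hs'
    have h1 : ∀ n : ℕ, p * δ * ((2 * n + 1 : ℝ) / (2 * (n + 1) + 1)) ^ d ≤
        (1 - ((2 * n + 1 : ℝ) / (2 * (n + 1) + 1)) ^ d) / s + 4 * s * 3 ^ d := by
      intro n
      have hpos : (0 : ℝ) < (2 * (n + 1) + 1 : ℝ) ^ d := by positivity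
      have h := mul_interface_le (p := p) hs hs' n hu
      rw [← hδ] at h
      rw [div_pow]
      set A := (2 * (n + 1) + 1 : ℝ) ^ d
      set B := (2 * n + 1 : ℝ) ^ d
      have h' := div_le_div_of_nonneg_right h hpos.le
      calc p * δ * (B / A) = p * (δ * B) / A := by ring
        _ ≤ _ := h'
        _ = _ := by field_simp
    have h2 := le_of_tendsto_of_tendsto' (hlim.const_mul (p * δ))
      (((hlim.const_sub 1).div_const s).add_const (4 * s * 3 ^ d)) h1
    simpa using h2
  have hδ0 : δ = 0 := by
    have hlim0 : Tendsto (fun s : ℝ => 4 * s * 3 ^ d) (𝓝[>] 0) (𝓝 0) := by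
      have : Continuous fun s : ℝ => 4 * s * 3 ^ d := by fun_prop
      have := this.tendsto 0
      simp only [mul_zero, zero_mul] at this
      exact this.mono_left nhdsWithin_le_nhds
    have hle : p * δ ≤ 0 := by
      refine ge_of_tendsto hlim0 ?_
      filter_upwards [Ioc_mem_nhdsGT (by norm_num : (0 : ℝ) < 1 / 2)] with s hs
      exact hbound s hs.1 hs.2
    have : 0 ≤ δ := measureReal_nonneg
    by_contra hne
    have : 0 < δ := lt_of_le_of_ne this (Ne.symm hne)
    nlinarith [mul_pos hp' this]
  rw [← hshift]
  rw [ae_iff]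
  simp only [not_not]
  rw [percolation_isInterface_map]
  exact (measureReal_eq_zero_iff).1 hδ0

/-- Uniqueness of the infinite cluster. -/
theorem ae_unique_infinite_cluster {p : unitInterval} (hp : 0 < p) :
    ∀ᵐ ω ∂percolation (lattice d) p, ∀ x y, (cluster ω x).verts.Infinite →
      (cluster ω y).verts.Infinite → (openGraph ω).Reachable x y :=
  ae_unique_of_ae_not_isInterface (lattice_preconnected d) hp (ae_not_isInterface hp)

end Lattice


/-! ### Absence of cut points for two transient paths. -/

section Deterministic

variable {V : Type*} {G : SimpleGraph V}

/-- The enlargement contains the whole open cluster of each of its vertices, and paths open in `ω'`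
never use the closed edge `e`, so they survive its deletion. -/
theorem reachable_of_mem_enlargement {ω : G.edgeSet → Bool} {H : G.Subgraph} {e : G.edgeSet}
    {ω' : G.edgeSet → Bool} (hle : ∀ e', ω' e' = true → ω e' = true) (hclosed : ω' e = false)
    {w v : V} (hw : w ∈ ((enlargement ω H).deleteEdges {(e : Sym2 V)}).verts)
    (h : (openGraph ω').Reachable w v) :
    ∃ hv : v ∈ ((enlargement ω H).deleteEdges {(e : Sym2 V)}).verts,
      ((enlargement ω H).deleteEdges {(e : Sym2 V)}).coe.Reachable ⟨w, hw⟩ ⟨v, hv⟩ := by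
  rw [SimpleGraph.reachable_iff_reflTransGen] at h
  induction h with
  | refl => exact ⟨hw, SimpleGraph.Reachable.refl _⟩
  | @tail u v _ huv ih =>
    obtain ⟨hu, hr⟩ := ih
    obtain ⟨hm, ho⟩ := huv
    have hu' : u ∈ ⋃ x ∈ H.verts, (cluster ω x).verts := hu
    simp only [Set.mem_iUnion] at hu'
    obtain ⟨x, hx, hxu⟩ := hu'
    have hadj : ((enlargement ω H).deleteEdges {(e : Sym2 V)}).Adj u v := by
      rw [SimpleGraph.Subgraph.deleteEdges_adj]
      refine ⟨.inr ⟨x, hx, hxu, hm, hle _ ho⟩, fun hmem => ?_⟩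
      have : (⟨s(u, v), hm⟩ : G.edgeSet) = e := Subtype.ext hmem
      rw [this, hclosed] at ho
      exact Bool.false_ne_true ho
    exact ⟨hadj.symm.fst_mem, hr.trans (SimpleGraph.Adj.reachable hadj)⟩

theorem subset_enlargement_verts (ω : G.edgeSet → Bool) (H : G.Subgraph) {x : V}
    (hx : x ∈ H.verts) : x ∈ (enlargement ω H).verts :=
  Set.mem_biUnion hx (SimpleGraph.Reachable.refl x)

/-- A transient path in `H` that meets the unique infinite cluster infinitely often is eventually
connected to this cluster in the enlargement of `H` without the edge `e`. -/
theorem eventually_reachable_of_transient {ω ω' : G.edgeSet → Bool} {H : G.Subgraph}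
    {e : G.edgeSet} (hle : ∀ e', ω' e' = true → ω e' = true) (hclosed : ω' e = false)
    (huniq : ∀ x y, (cluster ω' x).verts.Infinite → (cluster ω' y).verts.Infinite →
      (openGraph ω').Reachable x y)
    {S : ℕ → V} (hS : ∀ n, H.Adj (S n) (S (n + 1))) (htr : ∀ v, ∀ᶠ n in atTop, S n ≠ v)
    (hinf : ∃ᶠ n in atTop, (cluster ω' (S n)).verts.Infinite)
    (z : ((enlargement ω H).deleteEdges {(e : Sym2 V)}).verts)
    (hz : (cluster ω' z).verts.Infinite) :
    ∃ N, ∀ n ≥ N, ∀ hn : S n ∈ ((enlargement ω H).deleteEdges {(e : Sym2 V)}).verts,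
      ((enlargement ω H).deleteEdges {(e : Sym2 V)}).coe.Reachable ⟨S n, hn⟩ z := by
  have hverts : ∀ n, S n ∈ ((enlargement ω H).deleteEdges {(e : Sym2 V)}).verts := fun n =>
    subset_enlargement_verts ω H (hS n).fst_mem
  -- Once the path has left both endpoints of `e` for good, its steps survive the deletion and carry
  -- it to its next visit to the infinite cluster.
  have hav : ∀ᶠ n in atTop, S n ∉ (e : Sym2 V) := by
    obtain ⟨e, -⟩ := e
    induction e with | _ a b =>
    filter_upwards [htr a, htr b] with n ha hb hmem
    rcases Sym2.mem_iff.1 hmem with h | h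
    exacts [ha h, hb h]
  obtain ⟨N, hN⟩ := eventually_atTop.1 hav
  refine ⟨N, fun n hn hv => ?_⟩
  obtain ⟨m, hm, hmi⟩ := frequently_atTop.1 hinf n
  have hstep : ∀ k, ((enlargement ω H).deleteEdges {(e : Sym2 V)}).coe.Reachable ⟨S n, hv⟩
      ⟨S (n + k), hverts _⟩ := by
    intro k
    induction k with
    | zero => exact SimpleGraph.Reachable.refl _
    | succ k ih =>
      refine ih.trans (SimpleGraph.Adj.reachable ?_)
      change ((enlargement ω H).deleteEdges {(e : Sym2 V)}).Adj (S (n + k)) (S (n + k + 1))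
      rw [SimpleGraph.Subgraph.deleteEdges_adj]
      refine ⟨.inl (hS _), fun hmem => hN (n + k) (by omega) ?_⟩
      rw [← Set.mem_singleton_iff.1 hmem]
      exact Sym2.mem_mk_left _ _
  have h1 := hstep (m - n)
  have heq : n + (m - n) = m := by omega
  simp only [heq] at h1
  obtain ⟨_, h2⟩ := reachable_of_mem_enlargement hle hclosed (hverts m) (huniq _ _ hmi hz)
  exact h1.trans h2

/-- The deterministic part of the argument: if, after closing any edge, there is a unique infinite
cluster and two transient paths which cover the vertices of `H` meet it infinitely often, then the
enlargement of `H` has no cut points. -/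
theorem not_isCutPoint_of_transient [DecidableEq G.edgeSet] {ω : G.edgeSet → Bool} {H : G.Subgraph}
    {S S' : ℕ → V} (hH : ∀ x ∈ H.verts, (∃ n, S n = x) ∨ ∃ n, S' n = x)
    (hS : ∀ n, H.Adj (S n) (S (n + 1))) (hS' : ∀ n, H.Adj (S' n) (S' (n + 1)))
    (htr : ∀ v, ∀ᶠ n in atTop, S n ≠ v) (htr' : ∀ v, ∀ᶠ n in atTop, S' n ≠ v)
    (huniq : ∀ e x y, (cluster (Function.update ω e false) x).verts.Infinite →
      (cluster (Function.update ω e false) y).verts.Infinite →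
      (openGraph (Function.update ω e false)).Reachable x y)
    (hinf : ∀ e, ∃ᶠ n in atTop, (cluster (Function.update ω e false) (S n)).verts.Infinite)
    (hinf' : ∀ e, ∃ᶠ n in atTop, (cluster (Function.update ω e false) (S' n)).verts.Infinite)
    (x : V) : ¬ IsCutPoint (enlargement ω H) x := by
  rintro ⟨e, heX, -, hcard, hcomp⟩
  lift e to G.edgeSet using SimpleGraph.Subgraph.edgeSet_subset _ heX
  set ω' := Function.update ω e false with hω'
  have hle : ∀ e', ω' e' = true → ω e' = true := fun e' he' => by
    by_cases h : e' = e
    · subst h; simp [ω'] at he'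
    · simpa [ω', h] using he'
  have hclosed : ω' e = false := by simp [ω']
  obtain ⟨m, hm⟩ := (hinf e).exists
  set Y := (enlargement ω H).deleteEdges {(e : Sym2 V)} with hY
  let z : Y.verts := ⟨S m, subset_enlargement_verts ω H (hS m).fst_mem⟩
  obtain ⟨N, hN⟩ := eventually_reachable_of_transient hle hclosed (huniq e) hS htr (hinf e) z hm
  obtain ⟨N', hN'⟩ :=
    eventually_reachable_of_transient hle hclosed (huniq e) hS' htr' (hinf' e) z hm
  have hnontriv : Nontrivial Y.coe.ConnectedComponent := by
    -- `Nat.card` is zero on infinite types, so the value 2 also yields finiteness.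
    have : Finite Y.coe.ConnectedComponent := Nat.finite_of_card_ne_zero (by rw [hcard]; norm_num)
    rw [← Finite.one_lt_card_iff_nontrivial, hcard]
    norm_num
  obtain ⟨C, hC⟩ := exists_ne (Y.coe.connectedComponentMk z)
  have hnot : ∀ v : Y.verts, v ∈ C.supp → ¬ Y.coe.Reachable v z := fun v hv hr => by
    rw [SimpleGraph.ConnectedComponent.mem_supp_iff] at hv
    exact hC (hv ▸ SimpleGraph.ConnectedComponent.eq.2 hr)
  -- The possible entrances to a component `C` not containing `z`: initial points of the branches
  -- and endpoints of `e`, restricted to finite clusters. Their clusters will cover `C`,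
  -- contradicting its infinitude.
  let A : Set V := (S '' Set.Iio N ∪ S' '' Set.Iio N' ∪ {a | a ∈ (e : Sym2 V)}) ∩
    {w | (cluster ω' w).verts.Finite}
  have hA : A.Finite := by
    refine Set.Finite.subset (s := S '' Set.Iio N ∪ S' '' Set.Iio N' ∪ {a | a ∈ (e : Sym2 V)}) ?_
      Set.inter_subset_left
    refine (((Set.finite_Iio N).image S).union ((Set.finite_Iio N').image S')).union ?_
    obtain ⟨e, -⟩ := e
    induction e with | _ a b =>
    exact (Set.toFinite {a, b}).subset fun z hz => by simpa using hz
  have hAfin : (⋃ w ∈ A, (cluster ω' w).verts).Finite := hA.biUnion fun w hw => hw.2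
  refine (hcomp C).image Subtype.val_injective.injOn (hAfin.subset ?_)
  rintro _ ⟨⟨v, hv⟩, hvC, rfl⟩
  have hkey : ∀ w, (openGraph ω').Reachable v w →
      (∀ hw : w ∈ Y.verts, ¬ Y.coe.Reachable ⟨w, hw⟩ z →
        w ∈ S '' Set.Iio N ∪ S' '' Set.Iio N' ∪ {a | a ∈ (e : Sym2 V)}) →
      v ∈ ⋃ w ∈ A, (cluster ω' w).verts := by
    intro w hvw hw
    obtain ⟨hwY, hr⟩ := reachable_of_mem_enlargement hle hclosed hv hvw
    have hwz : ¬ Y.coe.Reachable ⟨w, hwY⟩ z := fun h => hnot _ hvC (hr.trans h)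
    refine Set.mem_biUnion (x := w) ⟨hw hwY hwz, ?_⟩ hvw.symm
    by_contra hcon
    obtain ⟨_, h⟩ := reachable_of_mem_enlargement hle hclosed hwY (huniq e w (S m) hcon hm)
    exact hwz h
  have hv' : v ∈ ⋃ x ∈ H.verts, (cluster ω x).verts := hv
  simp only [Set.mem_iUnion] at hv'
  obtain ⟨y, hy, hyv⟩ := hv'
  -- If closing `e` cuts `v` from the vertex `y` of `H` whose cluster contained it, the lost
  -- connection used `e`, so `v` still reaches an endpoint of `e`.
  by_cases hyv' : (openGraph ω').Reachable v y
  · refine hkey y hyv' fun hyY hyz => .inl ?_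
    rcases hH y hy with ⟨n, rfl⟩ | ⟨n, rfl⟩
    · exact .inl ⟨n, by_contra fun h => hyz (hN n (not_lt.1 h) hyY), rfl⟩
    · exact .inr ⟨n, by_contra fun h => hyz (hN' n (not_lt.1 h) hyY), rfl⟩
  · obtain ⟨a, ha, hva⟩ : ∃ a ∈ (e : Sym2 V), (openGraph ω').Reachable v a := by
      by_contra! hcon
      refine hyv' (reachable_of_forall_adj (A := openGraph ω)
        (fun u w _ hu ⟨hm, ho⟩ => ?_) hyv.symm)
      refine hu.trans (SimpleGraph.Adj.reachable ⟨hm, ?_⟩)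
      have hne : (⟨s(u, w), hm⟩ : G.edgeSet) ≠ e := fun h =>
        hcon u (by rw [← h]; exact Sym2.mem_mk_left u w) hu
      simpa [ω', hne] using ho
    exact hkey a hva fun _ _ => .inr ha

end Deterministic

/-! ### Cases in which the enlargement is the whole lattice. -/

section Lattice

variable {d : ℕ}

theorem lattice_deleteEdges_preconnected (hd : 2 ≤ d) (e : Sym2 (Fin d → ℤ)) :
    ((lattice d).deleteEdges {e}).Preconnected := by
  intro a b
  obtain ⟨w⟩ := lattice_preconnected d a b
  induction w with
  | nil => exact SimpleGraph.Reachable.refl _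
  | @cons x y b hxy w ih =>
    refine SimpleGraph.Reachable.trans ?_ ih
    by_cases he : s(x, y) = e
    · subst he
      -- Adjacent points agree in some coordinate once the dimension is at least two. Shifting the
      -- edge by one in that direction gives a three-step detour around it.
      obtain ⟨j, hj⟩ : ∃ j, x j = y j := by
        by_contra! hcon
        have h1 : ∀ i, 1 ≤ |x i - y i| := fun i => Int.one_le_abs (sub_ne_zero.2 (hcon i))
        have h2 := Finset.sum_le_sum fun i (_ : i ∈ Finset.univ) => h1 i
        rw [lattice_adj_iff.1 hxy] at h2
        simp at h2
        omega
      have hx : ∀ n : ℤ, n ≠ 0 → x + Pi.single j n ∉ s(x, y) ∧ y + Pi.single j n ∉ s(x, y) := by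
        intro n hn
        refine ⟨fun h => ?_, fun h => ?_⟩ <;> rcases Sym2.mem_iff.1 h with h | h <;>
          · have := congrFun h j
            simp at this
            omega
      obtain ⟨h1, h2⟩ := hx 1 one_ne_zero
      have hadj : ∀ u v : Fin d → ℤ, (lattice d).Adj u v → u ∉ s(x, y) →
          ((lattice d).deleteEdges {s(x, y)}).Adj u v := fun u v huv hu => by
        rw [SimpleGraph.deleteEdges_adj]
        refine ⟨huv, fun h => hu ?_⟩
        rw [← Set.mem_singleton_iff.1 h]
        exact Sym2.mem_mk_left u v
      exact ((hadj _ _ (adj_add_single x j).symm h1).symm.reachable.trans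
        (hadj _ _ (lattice_adj_add_right.2 hxy) h1).reachable).trans
        (hadj _ _ (adj_add_single y j).symm h2).reachable
    · exact SimpleGraph.Adj.reachable ((SimpleGraph.deleteEdges_adj).2 ⟨hxy, he⟩)

theorem not_isCutPoint_top (hd : 2 ≤ d) (x : Fin d → ℤ) :
    ¬ IsCutPoint (⊤ : (lattice d).Subgraph) x := by
  rintro ⟨e, -, -, hcard, -⟩
  have hpre : ((⊤ : (lattice d).Subgraph).deleteEdges {e}).coe.Preconnected := by
    rintro ⟨a, ha⟩ ⟨b, hb⟩
    let f : (lattice d).deleteEdges {e} →g ((⊤ : (lattice d).Subgraph).deleteEdges {e}).coe :=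
      { toFun := fun v => ⟨v, trivial⟩
        map_rel' := fun {u v} h => by
          rw [SimpleGraph.deleteEdges_adj] at h
          exact (SimpleGraph.Subgraph.deleteEdges_adj _ _ _).2 h }
    exact (lattice_deleteEdges_preconnected hd e a b).map f
  have := hpre.subsingleton_connectedComponent
  rw [← Finite.card_le_one_iff_subsingleton, hcard] at this
  omega

theorem enlargement_eq_top_of_open {ω : (lattice d).edgeSet → Bool} (hω : ∀ e, ω e = true)
    {H : (lattice d).Subgraph} (hH : H.verts.Nonempty) : enlargement ω H = ⊤ := by
  have hopen : openGraph ω = lattice d :=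
    le_antisymm (openGraph_le ω) fun u v h => ⟨h, hω _⟩
  obtain ⟨x, hx⟩ := hH
  have hr : ∀ u, (openGraph ω).Reachable x u := fun u => by
    rw [hopen]; exact lattice_preconnected d x u
  ext u v
  · exact ⟨fun _ => trivial, fun _ => Set.mem_biUnion hx (hr u)⟩
  · refine ⟨fun h => h.adj_sub, fun h => .inr ⟨x, hx, hr u, ?_⟩⟩
    rw [hopen]
    exact h

theorem enlargement_eq_top_of_le {V : Type*} {G : SimpleGraph V} (ω : G.edgeSet → Bool)
    {H : G.Subgraph} (hv : ∀ x, x ∈ H.verts) (hH : ∀ x y, G.Adj x y → H.Adj x y) :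
    enlargement ω H = ⊤ := by
  ext u v
  · exact ⟨fun _ => trivial, fun _ => subset_enlargement_verts ω H (hv u)⟩
  · exact ⟨fun h => h.adj_sub, fun h => .inl (hH u v h)⟩

end Lattice


/-! ### The random walk is transient or traverses every edge. -/

section Walk

variable {d : ℕ}

/-- The law of a step of the simple random walk. -/
noncomputable abbrev stepLaw (d : ℕ) : Measure (Fin d → ℤ) :=
  uniformOn ((lattice d).neighborSet 0)

theorem neighborSet_finite (d : ℕ) : ((lattice d).neighborSet 0).Finite :=
  (box d 1).finite_toSet.subset fun u hu => by
    rw [Finset.mem_coe, mem_box]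
    intro i
    simpa using abs_sub_le_of_adj hu i

theorem isProbabilityMeasure_stepLaw (hd : 0 < d) : IsProbabilityMeasure (stepLaw d) :=
  isProbabilityMeasure_uniformOn (neighborSet_finite d)
    ⟨Pi.single ⟨0, hd⟩ 1, by simpa using adj_add_single 0 (⟨0, hd⟩ : Fin d)⟩

theorem stepLaw_singleton_ne_zero {u : Fin d → ℤ} (hu : (lattice d).Adj 0 u) :
    stepLaw d {u} ≠ 0 := by
  intro h
  rw [uniformOn_eq_zero_iff (neighborSet_finite d)] at h
  exact (Set.ext_iff.1 h u).1 ⟨hu, rfl⟩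

theorem ae_stepLaw_adj (d : ℕ) : ∀ᵐ u ∂stepLaw d, (lattice d).Adj 0 u := by
  have : stepLaw d ((lattice d).neighborSet 0)ᶜ = 0 := by
    rw [uniformOn_eq_zero_iff (neighborSet_finite d)]
    simp
  exact this

/-- Lévy's Borel–Cantelli lemma: a vertex visited infinitely often is left infinitely often through
every given step. -/
theorem ae_frequently_step {ν : Measure (Fin d → ℤ)} [IsProbabilityMeasure ν] {u : Fin d → ℤ}
    (hu : ν {u} ≠ 0) (x v : Fin d → ℤ) :
    ∀ᵐ ξ ∂Measure.infinitePi fun _ : ℕ => ν, (∃ᶠ n in atTop, walk x ξ n = v) →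
      ∃ᶠ n in atTop, walk x ξ n = v ∧ ξ n = u := by
  set μ := Measure.infinitePi fun _ : ℕ => ν with hμ
  let X : ℕ → (ℕ → Fin d → ℤ) → Fin d → ℤ := fun n ξ => ξ n
  have hX : ∀ n, StronglyMeasurable (X n) := fun n => (measurable_pi_apply n).stronglyMeasurable
  let ℱ := Filtration.natural X hX
  have hind : iIndepFun X μ :=
    iIndepFun_infinitePi (P := fun _ : ℕ => ν) (X := fun _ b => b) fun _ => measurable_id
  have hXm : ∀ i j, i ≤ j → Measurable[ℱ j] (X i) := fun i j hij =>
    (comap_measurable (X i)).mono (le_iSup₂_of_le i hij le_rfl) le_rfl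
  have hwm : ∀ k, Measurable[ℱ k] fun ξ : ℕ → Fin d → ℤ => walk x ξ (k + 1) := fun k => by
    unfold walk
    refine Measurable.const_add ?_ x
    refine Finset.measurable_fun_sum _ fun i hi => hXm i k ?_
    have := Finset.mem_range.1 hi
    omega
  let A : ℕ → Set (ℕ → Fin d → ℤ) := fun k => {ξ | walk x ξ (k + 1) = v}
  let B : ℕ → Set (ℕ → Fin d → ℤ) := fun k => {ξ | ξ (k + 1) = u}
  -- `ℱ k` reveals steps 0 to `k`, hence the position at time `k + 1`, while step `k + 1` is fresh.
  -- The joint event therefore has index `k + 1`; the empty set at index 0 discards the visit at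
  -- time 0, which is harmless.
  let s : ℕ → Set (ℕ → Fin d → ℤ) := fun n => Nat.casesOn n ∅ fun k => A k ∩ B k
  have hA : ∀ k, MeasurableSet[ℱ k] (A k) := fun k => hwm k (measurableSet_singleton v)
  have hB : ∀ k, MeasurableSet[ℱ (k + 1)] (B k) := fun k =>
    hXm (k + 1) (k + 1) le_rfl (measurableSet_singleton u)
  have hs : ∀ n, MeasurableSet[ℱ n] (s n) := by
    rintro (_ | k)
    · exact @MeasurableSet.empty _ (ℱ 0)
    · exact (ℱ.mono (Nat.le_succ k) _ (hA k)).inter (hB k)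
  have hBμ : ∀ k, μ.real (B k) = ν.real {u} := fun k => by
    have := (measurePreserving_eval_infinitePi (fun _ : ℕ => ν) (k + 1)).measure_preimage
      (measurableSet_singleton u).nullMeasurableSet
    rw [measureReal_def, measureReal_def, ← this]
    rfl
  have hcond : ∀ k, μ[(s (k + 1)).indicator (1 : (ℕ → Fin d → ℤ) → ℝ) | ℱ k] =ᵐ[μ]
      (A k).indicator fun _ => ν.real {u} := by
    intro k
    have h1 : (s (k + 1)).indicator (1 : (ℕ → Fin d → ℤ) → ℝ) =
        (A k).indicator ((B k).indicator 1) := by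
      rw [Set.indicator_indicator]
    have hBm : MeasurableSet (B k) := ℱ.le _ _ (hB k)
    have hBc : MeasurableSet[MeasurableSpace.comap (X (k + 1)) inferInstance] (B k) :=
      ⟨{u}, measurableSet_singleton u, rfl⟩
    have h2 : μ[(B k).indicator (1 : (ℕ → Fin d → ℤ) → ℝ) | ℱ k] =ᵐ[μ] fun _ => ν.real {u} := by
      refine (condExp_indep_eq (hX (k + 1)).measurable.comap_le (ℱ.le k) ?_
        (hind.indep_comap_natural_of_lt hX (Nat.lt_succ_self k))).trans ?_
      · exact stronglyMeasurable_one.indicator hBc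
      · rw [integral_indicator_one hBm, hBμ]
    rw [h1]
    refine (condExp_indicator ?_ (hA k)).trans ?_
    · exact (integrable_const (1 : ℝ)).indicator hBm
    · filter_upwards [h2] with ξ hξ
      by_cases hmem : ξ ∈ A k
      · simp [hmem, hξ]
      · simp [hmem]
  have hpos : 0 < ν.real {u} := by
    rw [measureReal_def]
    exact ENNReal.toReal_pos hu (measure_ne_top _ _)
  filter_upwards [ae_mem_limsup_atTop_iff μ hs, ae_all_iff.2 hcond] with ξ h1 h2 hfreq
  have h3 : ξ ∈ limsup A atTop := by
    rw [mem_limsup_iff_frequently_mem, frequently_atTop]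
    intro N
    obtain ⟨n, hn, hv⟩ := frequently_atTop.1 hfreq (N + 1)
    refine ⟨n - 1, by omega, ?_⟩
    have : n - 1 + 1 = n := by omega
    simpa [A, this] using hv
  rw [Set.limsup_eq_tendsto_sum_indicator_atTop hpos] at h3
  simp only [h2] at h1
  have h4 := h1.2 h3
  rw [mem_limsup_iff_frequently_mem] at h4
  refine frequently_atTop.2 fun N => ?_
  obtain ⟨n, hn, hmem⟩ := frequently_atTop.1 h4 N
  cases n with
  | zero => exact absurd hmem (Set.notMem_empty ξ)
  | succ k => exact ⟨k + 1, hn, hmem⟩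

/-- Nearest-neighbour paths which are either transient or traverse every edge. -/
def IsRegularPath (S : ℕ → Fin d → ℤ) : Prop :=
  (∀ n, (lattice d).Adj (S n) (S (n + 1))) ∧
    ((∀ v, ∀ᶠ n in atTop, S n ≠ v) ∨
      ∀ x y, (lattice d).Adj x y → ∃ n, S n = x ∧ S (n + 1) = y)

theorem measurable_coord_eq (n : ℕ) (v : Fin d → ℤ) :
    Measurable fun S : ℕ → Fin d → ℤ => S n = v := by
  have h : Measurable fun S : ℕ → Fin d → ℤ => S n := measurable_pi_apply n
  exact measurableSet_setOfPred.1 (h (measurableSet_singleton v))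

theorem measurable_isTransient :
    Measurable fun S : ℕ → Fin d → ℤ => ∀ v, ∀ᶠ n in atTop, S n ≠ v := by
  simp only [eventually_atTop]
  exact .forall fun v => .exists fun N => .forall fun n => measurable_const.imp
    (measurable_coord_eq n v).not

theorem measurable_isRegularPath :
    Measurable fun S : ℕ → Fin d → ℤ => IsRegularPath S := by
  refine .and (.forall fun n => ?_) (measurable_isTransient.or (.forall fun x => .forall fun y =>
    measurable_const.imp (.exists fun n => (measurable_coord_eq n x).and
      (measurable_coord_eq (n + 1) y))))
  have : (fun S : ℕ → Fin d → ℤ => (lattice d).Adj (S n) (S (n + 1))) =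
      fun S => ∃ x y, (lattice d).Adj x y ∧ S n = x ∧ S (n + 1) = y := by
    ext S; simp
  rw [this]
  exact .exists fun x => .exists fun y => measurable_const.and
    ((measurable_coord_eq n x).and (measurable_coord_eq (n + 1) y))

theorem walk_succ (x : Fin d → ℤ) (ξ : ℕ → Fin d → ℤ) (n : ℕ) :
    walk x ξ (n + 1) = walk x ξ n + ξ n := by
  simp [walk, Finset.sum_range_succ, add_assoc]

theorem adj_add {x u : Fin d → ℤ} (hu : (lattice d).Adj 0 u) : (lattice d).Adj x (x + u) := by
  have := lattice_adj_add_right (a := x).2 hu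
  rwa [zero_add, add_comm] at this

theorem ae_isRegularPath (hd : 0 < d) (x : Fin d → ℤ) : ∀ᵐ S ∂srw d x, IsRegularPath S := by
  have := isProbabilityMeasure_stepLaw hd
  unfold srw
  rw [ae_map_iff (measurable_walk x).aemeasurable
    (measurableSet_setOfPred.2 measurable_isRegularPath)]
  have h1 : ∀ᵐ ξ ∂Measure.infinitePi fun _ : ℕ => stepLaw d, ∀ n, (lattice d).Adj 0 (ξ n) := by
    rw [ae_all_iff]
    exact fun n => (measurePreserving_eval_infinitePi
      (fun _ : ℕ => stepLaw d) n).quasiMeasurePreserving.ae (ae_stepLaw_adj d)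
  have h2 : ∀ᵐ ξ ∂Measure.infinitePi fun _ : ℕ => stepLaw d,
      ∀ (u v : Fin d → ℤ), (lattice d).Adj 0 u → (∃ᶠ n in atTop, walk x ξ n = v) →
      ∃ᶠ n in atTop, walk x ξ n = v ∧ ξ n = u := by
    rw [ae_all_iff]; intro u
    rw [ae_all_iff]; intro v
    by_cases hu : (lattice d).Adj 0 u
    · filter_upwards [ae_frequently_step (stepLaw_singleton_ne_zero hu) x v] with ξ h _ using h
    · exact ae_of_all _ fun ξ h => absurd h hu
  filter_upwards [h1, h2] with ξ h1 h2
  refine ⟨fun n => ?_, ?_⟩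
  · rw [walk_succ]; exact adj_add (h1 n)
  · by_cases htr : ∀ v, ∀ᶠ n in atTop, walk x ξ n ≠ v
    · exact .inl htr
    right
    push Not at htr
    obtain ⟨v, hv⟩ := htr
    replace hv : ∃ᶠ n in atTop, walk x ξ n = v := by simpa [Filter.Frequently] using hv
    have hstep : ∀ a b, (lattice d).Adj a b → (∃ᶠ n in atTop, walk x ξ n = a) →
        ∃ᶠ n in atTop, walk x ξ n = a ∧ walk x ξ (n + 1) = b := by
      intro a b hab ha
      have hu : (lattice d).Adj 0 (b - a) := by
        rw [← lattice_adj_add_right (a := a)]; simpa using hab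
      refine (h2 _ a hu ha).mono fun n hn => ⟨hn.1, ?_⟩
      rw [walk_succ, hn.1, hn.2, add_sub_cancel]
    -- Infinitely many visits spread along edges from `v` to every vertex, by connectedness.
    have hall : ∀ a, ∃ᶠ n in atTop, walk x ξ n = a := by
      intro a
      have hr := lattice_preconnected d v a
      rw [SimpleGraph.reachable_iff_reflTransGen] at hr
      induction hr with
      | refl => exact hv
      | @tail b c _ hbc ih =>
        rw [frequently_atTop]
        intro N
        obtain ⟨n, hn, h⟩ := frequently_atTop.1 (hstep b c hbc ih) N
        exact ⟨n + 1, by omega, h.2⟩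
    intro a b hab
    exact (hstep a b hab (hall a)).exists

theorem enlargement_eq_top_of_traverses {ω : (lattice d).edgeSet → Bool}
    {H : (lattice d).Subgraph} {S : ℕ → Fin d → ℤ} (hd : 0 < d) (hle : trace (lattice d) S ≤ H)
    (hS : ∀ x y, (lattice d).Adj x y → ∃ n, S n = x ∧ S (n + 1) = y) : enlargement ω H = ⊤ := by
  refine enlargement_eq_top_of_le ω (fun x => hle.1 ?_) fun x y h => hle.2 ?_
  · obtain ⟨n, hn, -⟩ := hS x _ (adj_add_single x ⟨0, hd⟩)
    exact ⟨n, hn⟩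
  · obtain ⟨n, hn⟩ := hS x y h
    exact ⟨h, n, .inl hn⟩

end Walk


/-! ### Combining walk and percolation. -/

section Main

theorem measurable_frequently_infinite {V Ω : Type*} {G : SimpleGraph V} [Countable V]
    [MeasurableSpace V] [MeasurableSingletonClass V] [MeasurableSpace Ω]
    {W : Ω → G.edgeSet → Bool} (hW : Measurable W) {S : Ω → ℕ → V} (hS : Measurable S) :
    Measurable fun z => ∃ᶠ n in atTop, (cluster (W z) (S z n)).verts.Infinite := by
  simp only [frequently_atTop]
  refine .forall fun N => .exists fun n => measurable_const.and ?_
  have : (fun z => (cluster (W z) (S z n)).verts.Infinite) =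
      fun z => ∃ x, S z n = x ∧ (cluster (W z) x).verts.Infinite := by
    ext z; simp
  rw [this]
  have hSn : Measurable fun z => S z n := (measurable_pi_apply n).comp hS
  exact .exists fun x => (measurableSet_setOfPred.1 (hSn (measurableSet_singleton x))).and
    (measurableSet_setOfPred.1 (hW (measurableSet_infinite x)))

variable {d : ℕ}

theorem percolation_infinite_pos {p : unitInterval} (hp : criticalProb (lattice d) 0 < p)
    (x : Fin d → ℤ) : 0 < percolation (lattice d) p {ω | (cluster ω x).verts.Infinite} := by
  obtain ⟨q, ⟨-, -, hq⟩, hqp⟩ := sInf_lt_iff.1 hp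
  rw [percolation_infinite_eq]
  exact hq.trans_le (percolation_infinite_mono hqp.le 0)

/-- By Fubini the path may be frozen, since it is independent of the percolation. The zero-one law
then applies to a deterministic transient path, and `ae_update` closes each of the countably many
edges. -/
theorem ae_transient_frequently_infinite {Ω : Type*} [MeasurableSpace Ω] (μ : Measure Ω) [SFinite μ]
    {T : Ω → ℕ → Fin d → ℤ} (hT : Measurable T) {p : unitInterval} (hp1 : p < 1)
    (hp : criticalProb (lattice d) 0 < p) :
    ∀ᵐ z ∂μ.prod (percolation (lattice d) p), (∀ v, ∀ᶠ n in atTop, T z.1 n ≠ v) →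
      ∀ e, ∃ᶠ n in atTop, (cluster (Function.update z.2 e false) (T z.1 n)).verts.Infinite := by
  have hb : bernoulliMeasure true false p {false} ≠ 0 := by
    rw [bernoulli_false]
    exact (ENNReal.ofReal_pos.2 (sub_pos.2 hp1)).ne'
  have : Countable (lattice d).edgeSet :=
    (Function.Injective.countable (f := fun e : (lattice d).edgeSet => (e : Sym2 (Fin d → ℤ)))
      Subtype.val_injective)
  have hTm : Measurable fun z : Ω × ((lattice d).edgeSet → Bool) => T z.1 := hT.comp measurable_fst
  have hupd : ∀ e, Measurable fun z : Ω × ((lattice d).edgeSet → Bool) =>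
      Function.update z.2 e false := fun e =>
    (measurable_update_prod e).comp (measurable_const.prodMk measurable_snd)
  have hmeas : Measurable fun z : Ω × ((lattice d).edgeSet → Bool) =>
      (∀ v, ∀ᶠ n in atTop, T z.1 n ≠ v) →
      ∀ e, ∃ᶠ n in atTop, (cluster (Function.update z.2 e false) (T z.1 n)).verts.Infinite :=
    (measurable_isTransient.comp hTm).imp
      (.forall fun e => measurable_frequently_infinite (hupd e) hTm)
  rw [Measure.ae_prod_iff_ae_ae (measurableSet_setOfPred.2 hmeas)]
  refine ae_of_all _ fun z => ?_
  by_cases htr : ∀ v, ∀ᶠ n in atTop, T z n ≠ v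
  · have h := ae_frequently_infinite (percolation_infinite_pos hp 0)
      (fun x => (percolation_infinite_eq p x).ge) htr
    filter_upwards [ae_all_iff.2 fun e => ae_update h e hb] with ω hω _ using hω
  · exact ae_of_all _ fun ω h => absurd h htr

theorem ae_open_of_one {V : Type*} (G : SimpleGraph V) [Countable V] :
    ∀ᵐ ω ∂percolation G 1, ∀ e, ω e = true := by
  have : Countable G.edgeSet :=
    (Function.Injective.countable (f := fun e : G.edgeSet => (e : Sym2 V)) Subtype.val_injective)
  rw [ae_all_iff]
  intro e
  refine (measurePreserving_eval_infinitePi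
    (fun _ : G.edgeSet => bernoulliMeasure true false 1) e).quasiMeasurePreserving.ae
      (p := fun b => b = true) ?_
  rw [bernoulliMeasure_one, ae_dirac_eq]
  rfl

/-- Above criticality the enlargement of the two-sided walk has no cut points. -/
theorem ae_not_isCutPoint (hd : 3 ≤ d) {p : unitInterval}
    (hp : criticalProb (lattice d) 0 < p) :
    ∀ᵐ z ∂(srwPair d 0 0).prod (percolation (lattice d) p),
      ∀ x, ¬ IsCutPoint (enlargement z.2 (twoSidedTrace z.1)) x := by
  have hd0 : 0 < d := by omega
  have hd2 : 2 ≤ d := by omega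
  have hsrw := isProbabilityMeasure_srw hd0 (0 : Fin d → ℤ)
  have hsrwPair : IsProbabilityMeasure (srwPair d 0 0) := by unfold srwPair; infer_instance
  -- At `p = 1` an edge is closed with probability zero, so the modification argument fails; there
  -- every edge is open and the enlargement is the whole lattice.
  rcases eq_or_lt_of_le (unitInterval.le_one' (t := p)) with rfl | hp1
  · have h : ∀ᵐ z ∂(srwPair d 0 0).prod (percolation (lattice d) 1), ∀ e, z.2 e = true :=
      Measure.quasiMeasurePreserving_snd.ae (ae_open_of_one (lattice d))
    filter_upwards [h] with z hz
    have hne : (twoSidedTrace z.1).verts.Nonempty := ⟨z.1.1 0, Or.inl ⟨0, rfl⟩⟩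
    rw [enlargement_eq_top_of_open hz hne]
    exact not_isCutPoint_top hd2
  · have hp0 : 0 < p := lt_of_le_of_lt unitInterval.nonneg' hp
    have hb : bernoulliMeasure true false p {false} ≠ 0 := by
      rw [bernoulli_false]
      exact (ENNReal.ofReal_pos.2 (sub_pos.2 hp1)).ne'
    have : Countable (lattice d).edgeSet :=
      (Function.Injective.countable (f := fun e : (lattice d).edgeSet => (e : Sym2 (Fin d → ℤ)))
        Subtype.val_injective)
    have huniq : ∀ᵐ z ∂(srwPair d 0 0).prod (percolation (lattice d) p), ∀ e x y,
        (cluster (Function.update z.2 e false) x).verts.Infinite →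
        (cluster (Function.update z.2 e false) y).verts.Infinite →
        (openGraph (Function.update z.2 e false)).Reachable x y :=
      Measure.quasiMeasurePreserving_snd.ae
        (ae_all_iff.2 fun e => ae_update (ae_unique_infinite_cluster hp0) e hb)
    have hpair1 : ∀ᵐ S ∂srwPair d 0 0, IsRegularPath S.1 :=
      Measure.quasiMeasurePreserving_fst.ae (ae_isRegularPath hd0 0)
    have hpair2 : ∀ᵐ S ∂srwPair d 0 0, IsRegularPath S.2 :=
      Measure.quasiMeasurePreserving_snd.ae (ae_isRegularPath hd0 0)
    have hreg1 : ∀ᵐ z ∂(srwPair d 0 0).prod (percolation (lattice d) p), IsRegularPath z.1.1 :=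
      Measure.quasiMeasurePreserving_fst.ae hpair1
    have hreg2 : ∀ᵐ z ∂(srwPair d 0 0).prod (percolation (lattice d) p), IsRegularPath z.1.2 :=
      Measure.quasiMeasurePreserving_fst.ae hpair2
    filter_upwards [huniq, hreg1, hreg2,
      ae_transient_frequently_infinite (srwPair d 0 0) measurable_fst hp1 hp,
      ae_transient_frequently_infinite (srwPair d 0 0) measurable_snd hp1 hp]
      with z hu h1 h2 hi1 hi2
    rcases h1.2 with htr1 | hall
    · rcases h2.2 with htr2 | hall
      · refine not_isCutPoint_of_transient ?_ (fun n => .inl ⟨h1.1 n, n, .inl ⟨rfl, rfl⟩⟩)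
          (fun n => .inr ⟨h2.1 n, n, .inl ⟨rfl, rfl⟩⟩) htr1 htr2 hu (hi1 htr1) (hi2 htr2)
        rintro x (⟨n, hn⟩ | ⟨n, hn⟩)
        exacts [.inl ⟨n, hn⟩, .inr ⟨n, hn⟩]
      · rw [enlargement_eq_top_of_traverses (H := twoSidedTrace z.1) hd0 le_sup_right hall]
        exact not_isCutPoint_top hd2
    · rw [enlargement_eq_top_of_traverses (H := twoSidedTrace z.1) hd0 le_sup_left hall]
      exact not_isCutPoint_top hd2

end Main

end PercEnlarge

theorem mainTheorem12 (d : ℕ) (hd : 3 ≤ d) (p : unitInterval)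
    (hp : PercEnlarge.criticalProb (PercEnlarge.lattice d) 0 < p) :
    ∀ᵐ z ∂((PercEnlarge.srwPair d 0 0).prod
        (PercEnlarge.percolation (PercEnlarge.lattice d) p)),
      ∀ x, ¬ PercEnlarge.IsCutPoint
        (PercEnlarge.enlargement z.2 (PercEnlarge.twoSidedTrace z.1)) x :=
  PercEnlarge.ae_not_isCutPoint hd hp
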